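/- Let $\mathbb R_+=(0,\infty)$, let $f\colon\mathbb R_+\to\mathbb R$ be strictly increasing and concave with $f(1)=0$, and put $E(x,y):=f(x/y)$ for $x,y>0$. Then $E$ is a deviation on $\mathbb R_+$: $E(x,x)=0$, and $y\mapsto E(x,y)$ is continuous and strictly decreasing for every $x>0$. For $x\in\mathbb R_+^n$ and weights $\lambda_1,\dots,\lambda_n\ge 0$ with positive sum, let $\mathscr D_E(x,\lambda)$ be the unique $y>0$ with $\sum_i\lambda_iE(x_i,y)=0$. For a simple function $g\colon[0,1)\to\mathbb R_+$, constant with value $v_i$ on each cell $D_i$ of a finite partition of $[0,1)$ into intervals $[a,b)$, put $\mathscr D_E(g):=\mathscr D_E\big((v_1,\dots,v_n),(|D_1|,\dots,|D_n|)\big)$. For $t>0$ and an integrable $h\colon[0,t)\to\mathbb R_+$, let $\tilde h(x):=h(tx)$ for $x\in[0,1)$, and for $\varepsilon>0$ let $B_\varepsilon(\tilde h)$ be the set of simple functions $g\colon[0,1)\to\mathbb R_+$ with $\|g-\tilde h\|_1<\varepsilon$ and $|\mathrm{Rg}(g)\setminus\mathrm{Rg}(\tilde h)|<\varepsilon$,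 where $\mathrm{Rg}$ denotes the smallest closed interval containing the range and $|\cdot|$ Lebesgue measure. Put $$\mathscr D_E^L(h):=\lim_{\varepsilon\to0}\inf_{g\in B_\varepsilon(\tilde h)}\mathscr D_E(g),\qquad \mathscr D_E^U(h):=\lim_{\varepsilon\to0}\sup_{g\in B_\varepsilon(\tilde h)}\mathscr D_E(g).$$ The integral deviation mean $\mathscr D_E^0(h)$ is well defined if $\mathscr D_E^L(h)=\mathscr D_E^U(h)$, and it is then this common value. Let $\mathcal L_C$ be the class of all integrable $h\colon[0,t)\to\mathbb R_+$, $t>0$, with values in some interval whose closure in $\mathbb R$ is contained in $(0,\infty)$, and with $\operatorname{ess\,sup}h=\sup h$ and $\operatorname{ess\,inf}h=\inf h$. Then $\mathscr D_E^0$ is well defined on $\mathcal L_C$. Now take as the domain of $\mathscr D_E^0$ any class $X\supseteq\mathcal L_C$ of integrable functions $h\colon[0,t)\to\mathbb R_+$, $t>0$, on which $\mathscr D_E^0$ is well defined (for example $\mathcal L_C$ itself, or the largest such class). Let the integral Hardy constant $\mathcal H$ of $\mathscr D_E^0$ be the smallest $C\in[0,\infty]$ such that $$\int_0^\infty\mathscr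 D_E^0\big(u|_{[0,t)}\big)\,dt\le C\int_0^\infty u(t)\,dt$$ for every integrable $u\colon[0,\infty)\to\mathbb R_+$ with $u|_{[0,t)}\in X$ for all $t>0$; the mean $\mathscr D_E^0$ is called Hardy if $\mathcal H<\infty$. Then $\mathscr D_E^0$ is Hardy if and only if $$\int_0^1 f\big(\tfrac1t\big)\,dt<\infty .$$ If this holds, then there is exactly one $c>0$ with $$\int_0^c f\big(\tfrac1t\big)\,dt=0$$ (in particular the integral converges), and $\mathcal H=c$. -/

import Mathlib

open Set MeasureTheory
open scoped ENNReal

noncomputable section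

namespace IntegralHardy

/-- `E` is a deviation on the interval `I`: it vanishes on the diagonal, and every `E x` is
continuous and strictly decreasing on `I`. -/
def IsDeviation (I : Set ℝ) (E : ℝ → ℝ → ℝ) : Prop :=
  (∀ x ∈ I, E x x = 0) ∧ ∀ x ∈ I, ContinuousOn (E x) I ∧ StrictAntiOn (E x) I

/-- Values of an `ℝ`-weighted mean: `M n x w` is the mean of the entries `x` with weights `w`. -/
abbrev WeightedMean := (n : ℕ) → (Fin n → ℝ) → (Fin n → ℝ) → ℝ

/-- The weighted deviation mean: the (for a deviation unique) solution `y ∈ I` of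
`∑ i, w i * E (x i) y = 0`. -/
def deviationMean (I : Set ℝ) (E : ℝ → ℝ → ℝ) : WeightedMean := fun n x w =>
  Classical.epsilon fun y : ℝ => y ∈ I ∧ ∑ i : Fin n, w i * E (x i) y = 0

/-- A simple function `[a, b) → I`: constant on each cell of a finite partition
`a = pt 0 < pt 1 < ⋯ < pt n = b` into half-open intervals. The values of `toFun` outside `[a, b)`
play no role. -/
structure SimpleFn (I : Set ℝ) (a b : ℝ) where
  n : ℕ
  pt : Fin (n + 1) → ℝ
  pt_strictMono : StrictMono pt
  pt_zero : pt 0 = a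
  pt_last : pt (Fin.last n) = b
  val : Fin n → ℝ
  val_mem : ∀ i, val i ∈ I
  toFun : ℝ → ℝ
  toFun_eq : ∀ i : Fin n, ∀ x ∈ Ico (pt i.castSucc) (pt i.succ), toFun x = val i

/-- The mean of a simple function: the weighted mean of its values, weighted by the lengths of
the cells. -/
def SimpleFn.mean {I : Set ℝ} {a b : ℝ} (M : WeightedMean) (g : SimpleFn I a b) : ℝ :=
  M g.n g.val fun i => g.pt i.succ - g.pt i.castSucc

/-- The smallest closed interval that contains the values of `h` on `[0, 1)`. -/
def valueRange (h : ℝ → ℝ) : Set ℝ :=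
  closure (convexHull ℝ (h '' Ico 0 1))

/-- The simple functions `g : [0, 1) → I` that are `ε`-close to `h`: the part of the value range of
`g` outside that of `h` has length less than `ε`, and the `L¹` distance is less than `ε`. -/
def vicinity (I : Set ℝ) (h : ℝ → ℝ) (ε : ℝ) : Set (SimpleFn I 0 1) :=
  {g | volume (valueRange g.toFun \ valueRange h) < ENNReal.ofReal ε ∧
    ∫⁻ x in Ico 0 1, ENNReal.ofReal |h x - g.toFun x| < ENNReal.ofReal ε}

/-- The function `f` restricted to `[0, t)`, transported to `[0, 1)` by the increasing affine
bijection. -/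
def rescale (f : ℝ → ℝ) (t : ℝ) : ℝ → ℝ := fun x => f (t * x)

/-- The lower mean of `f` on `[0, t)`: the limit, as `ε` decreases to `0`, of the infimum of the means
of the simple functions `ε`-close to the rescaled function. (The infimum is monotone in `ε`, so
the limit is a supremum.) -/
def lowerMean (M : WeightedMean) (I : Set ℝ) (f : ℝ → ℝ) (t : ℝ) : EReal :=
  ⨆ (ε : ℝ) (_ : 0 < ε), ⨅ g ∈ vicinity I (rescale f t) ε, ((g.mean M : ℝ) : EReal)

/-- The upper mean of `f` on `[0, t)`. -/
def upperMean (M : WeightedMean) (I : Set ℝ) (f : ℝ → ℝ) (t : ℝ) : EReal :=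
  ⨅ (ε : ℝ) (_ : 0 < ε), ⨆ g ∈ vicinity I (rescale f t) ε, ((g.mean M : ℝ) : EReal)

/-- The functions `f` whose restriction to `[0, t)` is an integrable function with values in `I`. -/
def integrableClass (I : Set ℝ) (t : ℝ) : Set (ℝ → ℝ) :=
  {f | IntegrableOn f (Ico 0 t) ∧ ∀ x ∈ Ico 0 t, f x ∈ I}

/-- The functions `f` for which the integral mean generated by `M` is well defined on `[0, t)`:
lower and upper mean coincide. -/
def meanDomain (M : WeightedMean) (I : Set ℝ) (t : ℝ) : Set (ℝ → ℝ) :=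
  {f | f ∈ integrableClass I t ∧ lowerMean M I f t = upperMean M I f t}

/-- The integral mean of `f` on `[0, t)` generated by `M`, meaningful for `f ∈ meanDomain M I t`:
the common value of lower and upper mean. -/
def integralMean (M : WeightedMean) (I : Set ℝ) (f : ℝ → ℝ) (t : ℝ) : EReal :=
  lowerMean M I f t

/-- The functions `f` whose restriction to `[0, t)` is integrable, takes its values in an interval
whose closure lies in the interior of `I`, and has essential supremum and infimum equal to its
supremum and infimum. -/
def deepClass (I : Set ℝ) (t : ℝ) : Set (ℝ → ℝ) :=
  {f | IntegrableOn f (Ico 0 t) ∧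
    (∃ S : Set ℝ, S.OrdConnected ∧ closure S ⊆ interior I ∧ ∀ x ∈ Ico 0 t, f x ∈ S) ∧
    essSup (fun x => (f x : EReal)) (volume.restrict (Ico 0 t)) = ⨆ x ∈ Ico 0 t, (f x : EReal) ∧
    essInf (fun x => (f x : EReal)) (volume.restrict (Ico 0 t)) = ⨅ x ∈ Ico 0 t, (f x : EReal)}

/-- The integral Hardy constant of a functional mean on `I`: the smallest `C ∈ [0, ∞]` with
`∫_0^∞ 𝔐 (f|[0, t)) dt ≤ C ∫_0^∞ f(t) dt` for every integrable `f : [0, ∞) → I` all of whose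
restrictions `f|[0, t)`, `t > 0`, belong to the domain of the mean. Here `f ∈ X t` says that
`f|[0, t)` belongs to the domain, and `𝔐 f t` is the mean of `f|[0, t)`. -/
def hardyConst (I : Set ℝ) (X : ℝ → Set (ℝ → ℝ)) (𝔐 : (ℝ → ℝ) → ℝ → EReal) : ℝ≥0∞ :=
  sInf {C | ∀ f : ℝ → ℝ, (∀ t, 0 ≤ t → f t ∈ I) → IntegrableOn f (Ici 0) →
    (∀ t, 0 < t → f ∈ X t) →
    ∫⁻ t in Ioi 0, (𝔐 f t).toENNReal ≤ C * ∫⁻ t in Ioi 0, ENNReal.ofReal (f t)}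

end IntegralHardy

end

noncomputable section

namespace IntegralHardy

/-! Upper bound. Let `q` be a supergradient of `f` and let `c` satisfy `∫₀^c f(1/t) dt = 0`, that
is, `∫₀¹ f(1/(cs)) ds = 0`. If `m` is the mean of a simple function `g`, apply the tangent
inequality at `1/(cs)` to the argument `g(s)/m` and integrate over `s`. The integral of `f(g/m)`
vanishes by definition of `m`, that of `f(1/(cs))` by choice of `c`, and what remains is the linear
bound `m ≤ K⁻¹ ∫₀¹ q(1/(cs)) g(s) ds` with `K = ∫₀¹ q(1/(cs))/(cs) ds` (`SimpleFn.mean_mul_le`). The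
kernel is bounded, so the bound is stable under `L¹` approximation and passes to the upper mean
(`upperMean_le_integral_kernel`). Integrating over the length of the interval, Tonelli and dilation
produce the factor `K⁻¹ ∫₀¹ q(1/(cs)) s⁻¹ ds = c` (`lintegral_integralMean_le`).

Lower bound. The extremal profile `1/s` is not integrable, so it is flattened on `[0,1]` and made to
decay like `T/s²` beyond `T`; its integral is then at most `log T + 2`. If some truncation of
`f(1/(ys))` has positive integral, the mean over `[0,t)` is at least `y/t` for `1/δ ≤ t ≤ T`, so the
left side of the Hardy inequality is at least `y log(δT)`. Letting `T → ∞` yields `C ≥ y`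
(`ofReal_le_of_hardy`). Every `y` in `(1,c)` is available when the integral of `f(1/t)` over `(0,1)`
is finite, every `y ≥ 1` when it is infinite.

Well-definedness. Away from `0` the function `f` is Lipschitz, so all simple functions near `h` have
nearly the same integral of `f(g/y)`; strict monotonicity in `y` then forces lower and upper mean to
agree (`lowerMean_eq_upperMean`). -/

/-! ### Supergradients and the deviation mean -/

/-- A strictly increasing concave function on `(0, ∞)` has a positive antitone supergradient. -/
lemma exists_supergradient {f : ℝ → ℝ} (hmono : StrictMonoOn f (Ioi 0))
    (hconc : ConcaveOn ℝ (Ioi 0) f) :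
    ∃ q : ℝ → ℝ, (∀ p, 0 < p → 0 < q p) ∧ AntitoneOn q (Ioi 0) ∧
      ∀ p, 0 < p → ∀ x, 0 < x → f x ≤ f p + q p * (x - p) := by
  have hconv : ConvexOn ℝ (Ioi 0) (-f) := hconc.neg
  have hint : ∀ p : ℝ, 0 < p → p ∈ interior (Ioi (0 : ℝ)) := fun p hp => by simpa using hp
  have key : ∀ p, 0 < p → ∀ x, 0 < x →
      f x ≤ f p + (-derivWithin (-f) (Ioi p) p) * (x - p) := by
    intro p hp x hx
    -- The right derivative of the convex function `-f` bounds slopes to the right of `p` from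
    -- below; to the left, slopes are at most the left derivative, hence at most the right one.
    rcases lt_trichotomy p x with h | rfl | h
    · have := hconv.rightDeriv_le_slope_of_mem_interior (hint p hp) hx h
      rw [slope_def_field, le_div_iff₀ (by linarith)] at this
      simp only [Pi.neg_apply] at this
      linarith
    · simp
    · have h1 := hconv.slope_le_leftDeriv_of_mem_interior hx (hint p hp) h
      have h2 := h1.trans (hconv.leftDeriv_le_rightDeriv_of_mem_interior (hint p hp))
      rw [slope_def_field, div_le_iff₀ (by linarith)] at h2
      simp only [Pi.neg_apply] at h2
      linarith
  refine ⟨fun p => -derivWithin (-f) (Ioi p) p, fun p hp => ?_, fun a ha b hb hab => ?_, key⟩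
  · have h1 := key p hp (p + 1) (by linarith)
    have h2 := hmono (mem_Ioi.2 hp) (mem_Ioi.2 (by linarith : 0 < p + 1)) (by linarith)
    linarith
  · rcases hab.eq_or_lt with rfl | hab
    · exact le_rfl
    -- Adding the tangent inequalities at `a` and at `b` leaves `0 ≤ (q a - q b) * (b - a)`.
    · have h1 := key a ha b hb
      have h2 := key b hb a ha
      show -derivWithin (-f) (Ioi b) b ≤ -derivWithin (-f) (Ioi a) a
      nlinarith

/-- Since `q` is antitone, all slopes on `[b, ∞)` are at most `q b`. This Lipschitz bound is what
makes means stable away from `0`. -/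
lemma abs_sub_le_of_supergradient {f q : ℝ → ℝ} (hqpos : ∀ p, 0 < p → 0 < q p)
    (hq : AntitoneOn q (Ioi 0)) (hf : ∀ p, 0 < p → ∀ x, 0 < x → f x ≤ f p + q p * (x - p))
    {b u v : ℝ} (hb : 0 < b) (hu : b ≤ u) (hv : b ≤ v) : |f u - f v| ≤ q b * |u - v| := by
  have one : ∀ u v, b ≤ u → b ≤ v → f u - f v ≤ q b * |u - v| := fun u v hu hv => by
    have h1 := hf v (by linarith) u (by linarith)
    have h2 := hq (mem_Ioi.2 hb) (mem_Ioi.2 (by linarith : 0 < v)) hv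
    calc f u - f v ≤ q v * (u - v) := by linarith
      _ ≤ q v * |u - v| := mul_le_mul_of_nonneg_left (le_abs_self _) (hqpos v (by linarith)).le
      _ ≤ q b * |u - v| := mul_le_mul_of_nonneg_right h2 (abs_nonneg _)
  refine abs_sub_le_iff.2 ⟨one u v hu hv, ?_⟩
  rw [abs_sub_comm]
  exact one v u hv hu

lemma continuousOn_of_concaveOn_Ioi {f : ℝ → ℝ} (hconc : ConcaveOn ℝ (Ioi 0) f) :
    ContinuousOn f (Ioi 0) :=
  hconc.continuousOn isOpen_Ioi

lemma continuousOn_div_right {f : ℝ → ℝ} (hconc : ConcaveOn ℝ (Ioi 0) f) {x : ℝ} (hx : 0 < x) :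
    ContinuousOn (fun y => f (x / y)) (Ioi 0) :=
  (continuousOn_of_concaveOn_Ioi hconc).comp
    (continuousOn_const.div continuousOn_id fun _ hy => (mem_Ioi.1 hy).ne')
    fun _ hy => div_pos hx hy

lemma strictAntiOn_div_right {f : ℝ → ℝ} (hmono : StrictMonoOn f (Ioi 0)) {x : ℝ} (hx : 0 < x) :
    StrictAntiOn (fun y => f (x / y)) (Ioi 0) := fun _ ha _ hb hab =>
  hmono (div_pos hx hb) (div_pos hx ha) (div_lt_div_of_pos_left hx ha hab)

lemma isDeviation_of_concave {f : ℝ → ℝ} (hmono : StrictMonoOn f (Ioi 0))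
    (hconc : ConcaveOn ℝ (Ioi 0) f) (hone : f 1 = 0) :
    IsDeviation (Ioi 0) fun x y => f (x / y) := by
  refine ⟨fun x hx => ?_, fun x hx =>
    ⟨continuousOn_div_right hconc hx, strictAntiOn_div_right hmono hx⟩⟩
  simp only [div_self (mem_Ioi.1 hx).ne', hone]

/-- The weighted sum is nonnegative at the smallest entry and nonpositive at the largest, so a zero
exists and the choice operator returns one. -/
lemma deviationMean_spec {f : ℝ → ℝ} (hmono : StrictMonoOn f (Ioi 0))
    (hconc : ConcaveOn ℝ (Ioi 0) f) (hone : f 1 = 0) {n : ℕ} [Nonempty (Fin n)]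
    {x w : Fin n → ℝ} (hx : ∀ i, 0 < x i) (hw : ∀ i, 0 ≤ w i) :
    0 < deviationMean (Ioi 0) (fun x y => f (x / y)) n x w ∧
      ∑ i, w i * f (x i / deviationMean (Ioi 0) (fun x y => f (x / y)) n x w) = 0 := by
  refine Classical.epsilon_spec (p := fun y : ℝ => y ∈ Ioi 0 ∧ ∑ i, w i * f (x i / y) = 0) ?_
  obtain ⟨i, hi⟩ := Finite.exists_min x
  obtain ⟨j, hj⟩ := Finite.exists_max x
  have hcont : ContinuousOn (fun y => ∑ i, w i * f (x i / y)) (Ioi 0) :=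
    continuousOn_finsetSum _ fun l _ => continuousOn_const.mul (continuousOn_div_right hconc (hx l))
  have h0 : (0 : ℝ) ∈ Icc (∑ l, w l * f (x l / x j)) (∑ l, w l * f (x l / x i)) := by
    constructor
    · refine Finset.sum_nonpos fun l _ => mul_nonpos_of_nonneg_of_nonpos (hw l) ?_
      rw [← hone]
      exact hmono.monotoneOn (div_pos (hx l) (hx j)) (mem_Ioi.2 one_pos)
        ((div_le_one (hx j)).2 (hj l))
    · refine Finset.sum_nonneg fun l _ => mul_nonneg (hw l) ?_
      rw [← hone]
      exact hmono.monotoneOn (mem_Ioi.2 one_pos) (div_pos (hx l) (hx i))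
        ((one_le_div (hx i)).2 (hi l))
  obtain ⟨y, hy, hy0⟩ := isPreconnected_Ioi.intermediate_value (hx j) (hx i) hcont h0
  exact ⟨y, hy, hy0⟩

/-! ### Simple functions and the integral equation for their means -/

namespace SimpleFn

variable {I : Set ℝ} {a b : ℝ}

lemma Ico_eq_iUnion (g : SimpleFn I a b) :
    Ico a b = ⋃ i : Fin g.n, Ico (g.pt i.castSucc) (g.pt i.succ) := by
  have key : ∀ k : Fin (g.n + 1), Ico a (g.pt k) ⊆
      ⋃ i : Fin g.n, Ico (g.pt i.castSucc) (g.pt i.succ) := by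
    intro k
    induction k using Fin.induction with
    | zero => simp [g.pt_zero]
    | succ i ih =>
      intro x hx
      by_cases h : x < g.pt i.castSucc
      · exact ih ⟨hx.1, h⟩
      · exact mem_iUnion.2 ⟨i, not_lt.1 h, hx.2⟩
  refine Subset.antisymm (by simpa [g.pt_last] using key (Fin.last _)) ?_
  refine iUnion_subset fun i => Ico_subset_Ico ?_ ?_
  · exact g.pt_zero.symm.trans_le (g.pt_strictMono.monotone (Fin.zero_le _))
  · exact (g.pt_strictMono.monotone (Fin.le_last _)).trans_eq g.pt_last

lemma pairwise_disjoint (g : SimpleFn I a b) :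
    Pairwise (Function.onFun Disjoint fun i : Fin g.n => Ico (g.pt i.castSucc) (g.pt i.succ)) := by
  refine (pairwise_disjoint_on _).2 fun i j hij => ?_
  refine Ico_disjoint_Ico.2 ((min_le_left _ _).trans (le_trans ?_ (le_max_right _ _)))
  exact g.pt_strictMono.monotone (Fin.succ_le_castSucc_iff.2 hij)

lemma toFun_mem (g : SimpleFn I a b) {x : ℝ} (hx : x ∈ Ico a b) : g.toFun x ∈ I := by
  rw [g.Ico_eq_iUnion] at hx
  obtain ⟨i, hi⟩ := mem_iUnion.1 hx
  rw [g.toFun_eq i x hi]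
  exact g.val_mem i

lemma cell_pos (g : SimpleFn I a b) (i : Fin g.n) : 0 < g.pt i.succ - g.pt i.castSucc :=
  sub_pos.2 (g.pt_strictMono Fin.castSucc_lt_succ)

lemma integrableOn_cell (g : SimpleFn I a b) (φ : ℝ → ℝ) (i : Fin g.n) :
    IntegrableOn (fun x => φ (g.toFun x)) (Ico (g.pt i.castSucc) (g.pt i.succ)) := by
  refine (integrableOn_const (C := φ (g.val i)) (by simp)).congr_fun (fun x hx => ?_)
    measurableSet_Ico
  rw [g.toFun_eq i x hx]

lemma integrableOn_comp (g : SimpleFn I a b) (φ : ℝ → ℝ) :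
    IntegrableOn (fun x => φ (g.toFun x)) (Ioo a b) := by
  refine IntegrableOn.mono_set ?_ Ioo_subset_Ico_self
  rw [g.Ico_eq_iUnion]
  exact integrableOn_finite_iUnion.2 fun i => g.integrableOn_cell φ i

lemma integral_comp (g : SimpleFn I a b) (φ : ℝ → ℝ) :
    ∫ x in Ioo a b, φ (g.toFun x) = ∑ i, (g.pt i.succ - g.pt i.castSucc) * φ (g.val i) := by
  rw [← integral_Ico_eq_integral_Ioo, g.Ico_eq_iUnion, integral_iUnion_fintype
    (fun _ => measurableSet_Ico) g.pairwise_disjoint (fun i => g.integrableOn_cell φ i)]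
  refine Finset.sum_congr rfl fun i _ => ?_
  rw [setIntegral_congr_fun measurableSet_Ico (g := fun _ => φ (g.val i)) fun x hx => by
    simp only [g.toFun_eq i x hx]]
  simp [(g.cell_pos i).le]

lemma nonempty_cells (g : SimpleFn I a b) (hab : a < b) : Nonempty (Fin g.n) := by
  have : a ∈ Ico a b := ⟨le_rfl, hab⟩
  rw [g.Ico_eq_iUnion] at this
  exact ⟨(mem_iUnion.1 this).choose⟩

end SimpleFn

/-- The deviation mean of a simple function is positive and solves the integral equation. -/
lemma SimpleFn.mean_spec {f : ℝ → ℝ} (hmono : StrictMonoOn f (Ioi 0))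
    (hconc : ConcaveOn ℝ (Ioi 0) f) (hone : f 1 = 0) (g : SimpleFn (Ioi 0) 0 1) :
    0 < g.mean (deviationMean (Ioi 0) fun x y => f (x / y)) ∧
      ∫ x in Ioo 0 1, f (g.toFun x / g.mean (deviationMean (Ioi 0) fun x y => f (x / y))) = 0 := by
  have := g.nonempty_cells one_pos
  have h := deviationMean_spec hmono hconc hone (x := g.val) g.val_mem fun i => (g.cell_pos i).le
  refine ⟨h.1, ?_⟩
  rw [g.integral_comp fun v => f (v / _)]
  exact h.2

lemma SimpleFn.antitoneOn_integral {f : ℝ → ℝ} (hmono : StrictMonoOn f (Ioi 0))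
    (g : SimpleFn (Ioi 0) 0 1) :
    AntitoneOn (fun y => ∫ x in Ioo 0 1, f (g.toFun x / y)) (Ioi 0) := fun y hy z hz hyz =>
  setIntegral_mono_on (g.integrableOn_comp fun v => f (v / z)) (g.integrableOn_comp fun v => f (v / y))
    measurableSet_Ioo fun _ hx =>
      (strictAntiOn_div_right hmono (g.toFun_mem (Ioo_subset_Ico_self hx))).antitoneOn hy hz hyz

lemma SimpleFn.le_mean {f : ℝ → ℝ} (hmono : StrictMonoOn f (Ioi 0))
    (hconc : ConcaveOn ℝ (Ioi 0) f) (hone : f 1 = 0) (g : SimpleFn (Ioi 0) 0 1) {y : ℝ}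
    (hy : 0 < y) (h : 0 < ∫ x in Ioo 0 1, f (g.toFun x / y)) :
    y ≤ g.mean (deviationMean (Ioi 0) fun x y => f (x / y)) := by
  obtain ⟨hm, hm0⟩ := g.mean_spec hmono hconc hone
  by_contra! hlt
  have := g.antitoneOn_integral hmono hm hy hlt.le
  simp only [hm0] at this
  linarith

lemma SimpleFn.mean_le {f : ℝ → ℝ} (hmono : StrictMonoOn f (Ioi 0))
    (hconc : ConcaveOn ℝ (Ioi 0) f) (hone : f 1 = 0) (g : SimpleFn (Ioi 0) 0 1) {y : ℝ}
    (hy : 0 < y) (h : ∫ x in Ioo 0 1, f (g.toFun x / y) < 0) :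
    g.mean (deviationMean (Ioi 0) fun x y => f (x / y)) ≤ y := by
  obtain ⟨hm, hm0⟩ := g.mean_spec hmono hconc hone
  by_contra! hlt
  have := g.antitoneOn_integral hmono hy hm hlt.le
  simp only [hm0] at this
  linarith

/-! ### Strict comparison, dilation and integrability -/

lemma setIntegral_lt_setIntegral {u v : ℝ → ℝ} {s : Set ℝ} (hs : MeasurableSet s)
    (h0 : volume s ≠ 0) (hu : IntegrableOn u s) (hv : IntegrableOn v s)
    (h : ∀ x ∈ s, u x < v x) : ∫ x in s, u x < ∫ x in s, v x := by
  rw [← sub_pos, ← integral_sub hv hu]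
  refine (setIntegral_pos_iff_support_of_nonneg_ae ?_ (hv.sub hu)).2 ?_
  · exact (ae_restrict_iff' hs).2 (ae_of_all _ fun x hx => (sub_pos.2 (h x hx)).le)
  · rw [inter_eq_self_of_subset_right]
    · exact pos_iff_ne_zero.2 h0
    · exact fun x hx => (sub_pos.2 (h x hx)).ne'

lemma preimage_mul_left_Ioo {t : ℝ} (ht : 0 < t) : (fun x => t * x) ⁻¹' Ioo 0 t = Ioo 0 1 := by
  ext x
  simp only [mem_preimage, mem_Ioo, mul_pos_iff_of_pos_left ht]
  rw [mul_lt_iff_lt_one_right ht]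

lemma preimage_mul_left_Ioi {t : ℝ} (ht : 0 < t) : (fun x => t * x) ⁻¹' Ioi 0 = Ioi 0 := by
  ext x
  simp only [mem_preimage, mem_Ioi, mul_pos_iff_of_pos_left ht]

lemma setLIntegral_comp_mul_left {t : ℝ} (ht : 0 < t) (s : Set ℝ) (φ : ℝ → ℝ≥0∞) :
    ∫⁻ x in (fun x => t * x) ⁻¹' s, φ (t * x) = ENNReal.ofReal t⁻¹ * ∫⁻ x in s, φ x := by
  have he := measurableEmbedding_mulLeft₀ ht.ne'
  rw [← he.lintegral_map, ← he.restrict_map, Real.map_volume_mul_left ht.ne',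
    Measure.restrict_smul, lintegral_smul_measure, abs_of_pos (inv_pos.2 ht), smul_eq_mul]

lemma setIntegrable_comp_mul_left {t : ℝ} (ht : 0 < t) {s : Set ℝ} {φ : ℝ → ℝ}
    (h : IntegrableOn φ s) : IntegrableOn (fun x => φ (t * x)) ((fun x => t * x) ⁻¹' s) := by
  have he := measurableEmbedding_mulLeft₀ ht.ne'
  have := he.integrableOn_map_iff (μ := volume) (f := φ) (s := s)
  refine this.1 ?_
  rw [Real.map_volume_mul_left ht.ne', IntegrableOn, Measure.restrict_smul]
  exact h.smul_measure ENNReal.ofReal_ne_top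

lemma integrableOn_rescale {h : ℝ → ℝ} {t : ℝ} (ht : 0 < t) (hh : IntegrableOn h (Ico 0 t)) :
    IntegrableOn (rescale h t) (Ioo 0 1) := by
  have := setIntegrable_comp_mul_left ht (hh.mono_set Ioo_subset_Ico_self)
  rwa [preimage_mul_left_Ioo ht] at this

/-- An increasing concave function of an integrable function bounded away from `0` is integrable. -/
lemma integrableOn_comp_of_le {f : ℝ → ℝ} (hmono : StrictMonoOn f (Ioi 0))
    (hconc : ConcaveOn ℝ (Ioi 0) f) {s : Set ℝ} (hs : MeasurableSet s) (hfin : volume s ≠ ⊤)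
    {u : ℝ → ℝ} (hu : IntegrableOn u s) {b : ℝ} (hb : 0 < b) (hbu : ∀ x ∈ s, b ≤ u x) :
    IntegrableOn (fun x => f (u x)) s := by
  obtain ⟨q, hq0, hq, hf⟩ := exists_supergradient hmono hconc
  -- Clamping the argument at `b` extends `f` continuously to the whole line without changing it on
  -- the values of `u`.
  have hfm : Continuous fun x => f (max b x) :=
    (continuousOn_of_concaveOn_Ioi hconc).comp_continuous (by fun_prop) fun x =>
      lt_of_lt_of_le hb (le_max_left _ _)
  have hae : AEStronglyMeasurable (fun x => f (u x)) (volume.restrict s) := by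
    refine (hfm.comp_aestronglyMeasurable hu.aestronglyMeasurable).congr ?_
    filter_upwards [ae_restrict_mem hs] with x hx
    rw [max_eq_right (hbu x hx)]
  have hbd : IntegrableOn (fun x => |f b| + q b * |u x - b|) s :=
    (integrableOn_const hfin).add
      (((hu.sub (integrableOn_const hfin)).abs).const_mul _)
  refine hbd.mono' hae ?_
  filter_upwards [ae_restrict_mem hs] with x hx
  have := abs_sub_le_of_supergradient hq0 hq hf hb (hbu x hx) le_rfl
  calc ‖f (u x)‖ = |f b + (f (u x) - f b)| := by rw [Real.norm_eq_abs]; congr 1; ring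
    _ ≤ |f b| + |f (u x) - f b| := abs_add_le _ _
    _ ≤ _ := by linarith

/-! ### Stability of the integral under approximation -/

lemma valueRange_subset {h : ℝ → ℝ} {K : Set ℝ} (hK : Convex ℝ K) (hKc : IsClosed K)
    (hh : ∀ x ∈ Ico (0 : ℝ) 1, h x ∈ K) : valueRange h ⊆ K :=
  closure_minimal (convexHull_min (image_subset_iff.2 hh) hK) hKc

lemma Icc_subset_valueRange (h : ℝ → ℝ) {x y : ℝ} (hx : x ∈ Ico (0 : ℝ) 1)
    (hy : y ∈ Ico (0 : ℝ) 1) : Icc (h x) (h y) ⊆ valueRange h :=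
  ((convex_convexHull ℝ _).ordConnected.out (subset_convexHull ℝ _ (mem_image_of_mem h hx))
    (subset_convexHull ℝ _ (mem_image_of_mem h hy))).trans subset_closure

lemma vicinity_mono (I : Set ℝ) (h : ℝ → ℝ) {ε δ : ℝ} (hεδ : ε ≤ δ) :
    vicinity I h ε ⊆ vicinity I h δ := fun _ hg =>
  ⟨hg.1.trans_le (ENNReal.ofReal_le_ofReal hεδ), hg.2.trans_le (ENNReal.ofReal_le_ofReal hεδ)⟩

/-- Simple functions close to a function that is bounded below by `a` are bounded below by `a / 2`. -/
lemma half_le_of_mem_vicinity {I : Set ℝ} {h : ℝ → ℝ} {a ε : ℝ} (hε : 0 < ε) (hεa : ε ≤ a / 4)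
    (ha : ∀ x ∈ Ico (0 : ℝ) 1, a ≤ h x) {g : SimpleFn I 0 1} (hg : g ∈ vicinity I h ε)
    {x : ℝ} (hx : x ∈ Ico (0 : ℝ) 1) : a / 2 ≤ g.toFun x := by
  by_contra! hlt
  -- Otherwise `h - g ≥ ε` everywhere, against the `L¹` condition.
  obtain ⟨y, hy, hgy⟩ : ∃ y ∈ Ico (0 : ℝ) 1, a - ε < g.toFun y := by
    by_contra! hall
    refine hg.2.not_ge ?_
    calc ENNReal.ofReal ε = ∫⁻ _ in Ico (0 : ℝ) 1, ENNReal.ofReal ε := by simp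
      _ ≤ _ := setLIntegral_mono' measurableSet_Ico fun y hy =>
        ENNReal.ofReal_le_ofReal ((by linarith [ha y hy, hall y hy] : ε ≤ h y - g.toFun y).trans
          (le_abs_self _))
  -- The range of `g` now covers `[a/2, a - ε)`, which lies below the range of `h` and has length
  -- `a/2 - ε ≥ ε`.
  refine hg.1.not_ge ?_
  calc ENNReal.ofReal ε ≤ ENNReal.ofReal (a - ε - a / 2) := ENNReal.ofReal_le_ofReal (by linarith)
    _ = volume (Ico (a / 2) (a - ε)) := Real.volume_Ico.symm
    _ ≤ volume (valueRange g.toFun \ valueRange h) := measure_mono fun z hz =>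
      ⟨Icc_subset_valueRange _ hx hy ⟨by linarith [hz.1], by linarith [hz.2]⟩, fun hz' => by
        have := valueRange_subset (convex_Ici a) isClosed_Ici ha hz'
        linarith [hz.2, mem_Ici.1 this]⟩

/-- Both `g/y` and `h/y` stay above `a/(2y)`, where `f` has Lipschitz constant `q (a/2/y)`. -/
lemma abs_integral_sub_le_of_mem_vicinity {f q : ℝ → ℝ} (hmono : StrictMonoOn f (Ioi 0))
    (hconc : ConcaveOn ℝ (Ioi 0) f) (hqpos : ∀ p, 0 < p → 0 < q p)
    (hq : AntitoneOn q (Ioi 0)) (hf : ∀ p, 0 < p → ∀ x, 0 < x → f x ≤ f p + q p * (x - p))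
    {I : Set ℝ} {h : ℝ → ℝ} (hh : IntegrableOn h (Ioo 0 1)) {a ε y : ℝ} (hε : 0 < ε)
    (hεa : ε ≤ a / 4) (hy : 0 < y) (ha : ∀ x ∈ Ico (0 : ℝ) 1, a ≤ h x) {g : SimpleFn I 0 1}
    (hg : g ∈ vicinity I h ε) :
    |(∫ x in Ioo 0 1, f (g.toFun x / y)) - ∫ x in Ioo 0 1, f (h x / y)| ≤
      q (a / 2 / y) * (ε / y) := by
  have ha0 : 0 < a := by linarith
  have hb : 0 < a / 2 / y := by positivity
  have hgb : ∀ x ∈ Ioo (0 : ℝ) 1, a / 2 / y ≤ g.toFun x / y := fun x hx =>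
    div_le_div_of_nonneg_right (half_le_of_mem_vicinity hε hεa ha hg (Ioo_subset_Ico_self hx)) hy.le
  have hhb : ∀ x ∈ Ioo (0 : ℝ) 1, a / 2 / y ≤ h x / y := fun x hx =>
    div_le_div_of_nonneg_right (by linarith [ha x (Ioo_subset_Ico_self hx)]) hy.le
  have hd : IntegrableOn (fun x => h x - g.toFun x) (Ioo 0 1) := hh.sub (g.integrableOn_comp id)
  have hlt : ∫ x in Ioo 0 1, |h x - g.toFun x| ≤ ε := by
    rw [← ENNReal.ofReal_le_ofReal_iff hε.le,
      ofReal_integral_eq_lintegral_ofReal hd.abs (ae_of_all _ fun _ => abs_nonneg _)]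
    exact (lintegral_mono_set Ioo_subset_Ico_self).trans hg.2.le
  rw [← integral_sub (g.integrableOn_comp fun v => f (v / y))
    (integrableOn_comp_of_le hmono hconc measurableSet_Ioo (by simp) (hh.div_const y) hb hhb)]
  calc _ ≤ ∫ x in Ioo 0 1, |f (g.toFun x / y) - f (h x / y)| := abs_integral_le_integral_abs
    _ ≤ ∫ x in Ioo 0 1, q (a / 2 / y) / y * |h x - g.toFun x| := by
      refine setIntegral_mono_on ?_ (hd.abs.const_mul _) measurableSet_Ioo fun x hx => ?_
      · exact ((g.integrableOn_comp fun v => f (v / y)).sub (integrableOn_comp_of_le hmono hconc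
          measurableSet_Ioo (by simp) (hh.div_const y) hb hhb)).abs
      · refine (abs_sub_le_of_supergradient hqpos hq hf hb (hgb x hx) (hhb x hx)).trans_eq ?_
        rw [← sub_div, abs_div, abs_of_pos hy, abs_sub_comm]
        ring
    _ = q (a / 2 / y) / y * ∫ x in Ioo 0 1, |h x - g.toFun x| := integral_const_mul _ _
    _ ≤ q (a / 2 / y) / y * ε :=
      mul_le_mul_of_nonneg_left hlt (div_pos (hqpos _ hb) hy).le
    _ = _ := by ring

/-- All simple functions close to `h` have almost the same integral as `h`. -/
lemma exists_vicinity_abs_integral_sub_lt {f : ℝ → ℝ} (hmono : StrictMonoOn f (Ioi 0))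
    (hconc : ConcaveOn ℝ (Ioi 0) f) {I : Set ℝ} {h : ℝ → ℝ} (hh : IntegrableOn h (Ioo 0 1))
    {a y δ : ℝ} (ha0 : 0 < a) (hy : 0 < y) (hδ : 0 < δ) (ha : ∀ x ∈ Ico (0 : ℝ) 1, a ≤ h x) :
    ∃ ε, 0 < ε ∧ ∀ g ∈ vicinity I h ε,
      |(∫ x in Ioo 0 1, f (g.toFun x / y)) - ∫ x in Ioo 0 1, f (h x / y)| < δ := by
  obtain ⟨q, hq0, hq, hf⟩ := exists_supergradient hmono hconc
  have hL : 0 < q (a / 2 / y) / y := div_pos (hq0 _ (by positivity)) hy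
  refine ⟨min (a / 4) (δ / 2 / (q (a / 2 / y) / y)), by positivity, fun g hg => ?_⟩
  refine (abs_integral_sub_le_of_mem_vicinity hmono hconc hq0 hq hf hh (by positivity)
    (min_le_left _ _) hy ha hg).trans_lt ?_
  calc _ = q (a / 2 / y) / y * min (a / 4) (δ / 2 / (q (a / 2 / y) / y)) := by ring
    _ ≤ q (a / 2 / y) / y * (δ / 2 / (q (a / 2 / y) / y)) :=
      mul_le_mul_of_nonneg_left (min_le_right _ _) hL.le
    _ = δ / 2 := mul_div_cancel₀ _ hL.ne'
    _ < δ := by linarith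

lemma rescale_mem {h : ℝ → ℝ} {t : ℝ} {K : Set ℝ} (ht : 0 < t) (hh : ∀ x ∈ Ico 0 t, h x ∈ K) :
    ∀ x ∈ Ico (0 : ℝ) 1, rescale h t x ∈ K := fun _ hx =>
  hh _ ⟨mul_nonneg ht.le hx.1, (mul_lt_iff_lt_one_right ht).2 hx.2⟩

lemma le_lowerMean {f : ℝ → ℝ} (hmono : StrictMonoOn f (Ioi 0))
    (hconc : ConcaveOn ℝ (Ioi 0) f) (hone : f 1 = 0) {h : ℝ → ℝ} {t a y : ℝ} (ht : 0 < t)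
    (hh : IntegrableOn h (Ico 0 t)) (ha0 : 0 < a) (ha : ∀ x ∈ Ico 0 t, a ≤ h x) (hy : 0 < y)
    (hpos : 0 < ∫ x in Ioo 0 1, f (rescale h t x / y)) :
    (y : EReal) ≤ lowerMean (deviationMean (Ioi 0) fun x y => f (x / y)) (Ioi 0) h t := by
  obtain ⟨ε, hε, hg⟩ := exists_vicinity_abs_integral_sub_lt hmono hconc (I := Ioi 0)
    (integrableOn_rescale ht hh) ha0 hy hpos (rescale_mem (K := Ici a) ht ha)
  refine le_iSup₂_of_le ε hε (le_iInf₂ fun g hgv => ?_)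
  refine EReal.coe_le_coe_iff.2 (g.le_mean hmono hconc hone hy ?_)
  have := (abs_lt.1 (hg g hgv)).1
  linarith

lemma upperMean_le {f : ℝ → ℝ} (hmono : StrictMonoOn f (Ioi 0))
    (hconc : ConcaveOn ℝ (Ioi 0) f) (hone : f 1 = 0) {h : ℝ → ℝ} {t a y : ℝ} (ht : 0 < t)
    (hh : IntegrableOn h (Ico 0 t)) (ha0 : 0 < a) (ha : ∀ x ∈ Ico 0 t, a ≤ h x) (hy : 0 < y)
    (hneg : ∫ x in Ioo 0 1, f (rescale h t x / y) < 0) :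
    upperMean (deviationMean (Ioi 0) fun x y => f (x / y)) (Ioi 0) h t ≤ y := by
  obtain ⟨ε, hε, hg⟩ := exists_vicinity_abs_integral_sub_lt hmono hconc (I := Ioi 0)
    (integrableOn_rescale ht hh) ha0 hy (neg_pos.2 hneg) (rescale_mem (K := Ici a) ht ha)
  refine iInf₂_le_of_le ε hε (iSup₂_le fun g hgv => ?_)
  refine EReal.coe_le_coe_iff.2 (g.mean_le hmono hconc hone hy ?_)
  have := (abs_lt.1 (hg g hgv)).2
  linarith

/-! ### Approximation by step functions with values of the given function -/

/-- First moment method: some value of `h` is at most as far from `c` as `h` is on average. -/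
lemma exists_mem_lintegral_sub_le {h : ℝ → ℝ} {s : Set ℝ}
    (h0 : volume s ≠ 0) (hfin : volume s ≠ ⊤) (hh : IntegrableOn h s) (c : ℝ) :
    ∃ ξ ∈ s, ∫⁻ x in s, ENNReal.ofReal |h x - h ξ| ≤
      2 * ∫⁻ x in s, ENNReal.ofReal |h x - c| := by
  have hm : AEMeasurable (fun x => ENNReal.ofReal |h x - c|) (volume.restrict s) :=
    (continuous_abs.measurable.comp_aemeasurable (hh.aemeasurable.sub_const c)).ennreal_ofReal
  obtain ⟨ξ, hξ, hle⟩ := exists_le_setLAverage h0 hfin hm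
  refine ⟨ξ, hξ, ?_⟩
  rw [setLAverage_eq, ENNReal.le_div_iff_mul_le (Or.inl h0) (Or.inl hfin)] at hle
  calc ∫⁻ x in s, ENNReal.ofReal |h x - h ξ|
      ≤ ∫⁻ x in s, (ENNReal.ofReal |h x - c| + ENNReal.ofReal |h ξ - c|) := by
        refine lintegral_mono fun x => ?_
        rw [← ENNReal.ofReal_add (abs_nonneg _) (abs_nonneg _), abs_sub_comm (h ξ) c]
        exact ENNReal.ofReal_le_ofReal (abs_sub_le _ _ _)
    _ = (∫⁻ x in s, ENNReal.ofReal |h x - c|) + ENNReal.ofReal |h ξ - c| * volume s := by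
        rw [lintegral_add_right _ measurable_const, setLIntegral_const]
    _ ≤ _ := by rw [two_mul]; gcongr

/-- Step functions with values among those of `h` approximate an integrable function `h`. -/
lemma vicinity_nonempty {I : Set ℝ} {h : ℝ → ℝ} (hh : IntegrableOn h (Ico 0 1))
    (hI : ∀ x ∈ Ico (0 : ℝ) 1, h x ∈ I) {ε : ℝ} (hε : 0 < ε) : (vicinity I h ε).Nonempty := by
  -- The `L¹` error of `φ` and its oscillation on a cell each cost `ε/8`; the first moment method
  -- doubles the sum, leaving `ε/2`.
  obtain ⟨φ, -, hφ, hφc, -⟩ := Integrable.exists_hasCompactSupport_lintegral_sub_le hh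
    (ENNReal.ofReal_pos.2 (by positivity : 0 < ε / 8)).ne'
  obtain ⟨δ, hδ, hδφ⟩ := Metric.uniformContinuousOn_iff.1
    (isCompact_Icc.uniformContinuousOn_of_continuous (s := Icc (0 : ℝ) 1) hφc.continuousOn)
    (ε / 8) (by positivity)
  obtain ⟨n, hn⟩ := exists_nat_one_div_lt hδ
  have hN : (0 : ℝ) < n + 1 := by positivity
  -- Sampling `h` itself, not `φ`, keeps the range of the step function inside that of `h`. Indices
  -- run over all of `ℕ`, with a dummy point beyond the last cell, so that a floor can select the
  -- cell.
  have hcell : ∀ i : ℕ, ∃ ξ : ℝ, i < n + 1 → ξ ∈ Ico ((i : ℝ) / (n + 1)) ((i + 1 : ℝ) / (n + 1)) ∧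
      ∫⁻ x in Ico ((i : ℝ) / (n + 1)) ((i + 1 : ℝ) / (n + 1)), ENNReal.ofReal |h x - h ξ| ≤
        2 * ∫⁻ x in Ico ((i : ℝ) / (n + 1)) ((i + 1 : ℝ) / (n + 1)),
          ENNReal.ofReal |h x - φ (i / (n + 1))| := by
    intro i
    by_cases hi : i < n + 1
    · have hlt : (i : ℝ) / (n + 1) < (i + 1 : ℝ) / (n + 1) := by gcongr; linarith
      obtain ⟨ξ, h1, h2⟩ := exists_mem_lintegral_sub_le (h := h)
        (by simpa using hlt) (by simp) (hh.mono_set (Ico_subset_Ico (by positivity)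
          ((div_le_one hN).2 (by exact_mod_cast hi)))) (φ (i / (n + 1)))
      exact ⟨ξ, fun _ => ⟨h1, h2⟩⟩
    · exact ⟨0, fun hi' => absurd hi' hi⟩
  choose ξ hξ using hcell
  have hsub : ∀ i < n + 1, Ico ((i : ℝ) / (n + 1)) ((i + 1 : ℝ) / (n + 1)) ⊆ Ico 0 1 := fun i hi =>
    Ico_subset_Ico (by positivity) ((div_le_one hN).2 (by exact_mod_cast hi))
  let g : SimpleFn I 0 1 :=
    { n := n + 1
      pt := fun i => (i : ℕ) / (n + 1)
      pt_strictMono := fun i j hij => by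
        have : (i : ℝ) < (j : ℕ) := by exact_mod_cast hij
        exact div_lt_div_of_pos_right this hN
      pt_zero := by simp
      pt_last := by simp [hN.ne']
      val := fun i => h (ξ i)
      val_mem := fun i => hI _ (hsub i i.2 (hξ i i.2).1)
      toFun := fun x => h (ξ ⌊(n + 1) * x⌋₊)
      toFun_eq := fun i x hx => by
        have h1 : (i : ℕ) ≤ (n + 1) * x := by
          have := hx.1
          simp only [Fin.val_castSucc] at this
          rwa [div_le_iff₀' hN] at this
        have h2 : (n + 1) * x < (i : ℕ) + 1 := by
          have := hx.2
          simp only [Fin.val_succ, Nat.cast_add, Nat.cast_one] at this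
          rwa [lt_div_iff₀' hN] at this
        rw [(Nat.floor_eq_iff ((Nat.cast_nonneg _).trans h1)).2 ⟨h1, h2⟩] }
  have hrange : valueRange g.toFun ⊆ valueRange h := by
    refine closure_mono (convexHull_mono ?_)
    rintro _ ⟨x, hx, rfl⟩
    rw [g.Ico_eq_iUnion] at hx
    obtain ⟨i, hi⟩ := mem_iUnion.1 hx
    rw [g.toFun_eq i x hi]
    exact mem_image_of_mem h (hsub i i.2 (hξ i i.2).1)
  refine ⟨g, ?_, ?_⟩
  · rw [sdiff_eq_empty.2 hrange, measure_empty]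
    exact ENNReal.ofReal_pos.2 hε
  · let Ψ : ℝ → ℝ≥0∞ := fun x => ENNReal.ofReal |h x - φ x| + ENNReal.ofReal (ε / 8)
    have hcells : ∀ i : Fin g.n,
        ∫⁻ x in Ico (g.pt i.castSucc) (g.pt i.succ), ENNReal.ofReal |h x - g.toFun x| ≤
          2 * ∫⁻ x in Ico (g.pt i.castSucc) (g.pt i.succ), Ψ x := by
      intro i
      have e1 : g.pt i.castSucc = ((i : ℕ) : ℝ) / (n + 1) := rfl
      have e2 : g.pt i.succ = (((i : ℕ) : ℝ) + 1) / (n + 1) := by simp [g]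
      rw [setLIntegral_congr_fun (g := fun x => ENNReal.ofReal |h x - h (ξ i)|) measurableSet_Ico
        fun x hx => by simp only [g.toFun_eq i x hx]; rfl, e1, e2]
      refine (hξ i i.2).2.trans (mul_le_mul_right ?_ 2)
      refine setLIntegral_mono' measurableSet_Ico fun x hx => ?_
      simp only [Ψ]
      rw [← ENNReal.ofReal_add (abs_nonneg _) (by positivity)]
      refine ENNReal.ofReal_le_ofReal ((abs_sub_le _ (φ x) _).trans (add_le_add_right ?_ _))
      have hx' := hsub i i.2 hx
      refine (hδφ x (Ico_subset_Icc_self hx') ((i : ℕ) / (n + 1)) ⟨by positivity, ?_⟩ ?_).le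
      · exact (div_le_one hN).2 (by exact_mod_cast i.2.le)
      · rw [Real.dist_eq, abs_of_nonneg (sub_nonneg.2 hx.1)]
        refine lt_of_le_of_lt ?_ hn
        have := hx.2
        rw [add_div] at this
        linarith
    have hmeas : ∀ i : Fin g.n, MeasurableSet (Ico (g.pt i.castSucc) (g.pt i.succ)) :=
      fun _ => measurableSet_Ico
    calc ∫⁻ x in Ico 0 1, ENNReal.ofReal |h x - g.toFun x|
        = ∑' i : Fin g.n,
          ∫⁻ x in Ico (g.pt i.castSucc) (g.pt i.succ), ENNReal.ofReal |h x - g.toFun x| := by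
          conv_lhs => rw [g.Ico_eq_iUnion]
          exact lintegral_iUnion hmeas g.pairwise_disjoint _
      _ ≤ ∑' i : Fin g.n, 2 * ∫⁻ x in Ico (g.pt i.castSucc) (g.pt i.succ), Ψ x :=
          ENNReal.tsum_le_tsum hcells
      _ = 2 * ∫⁻ x in Ico 0 1, Ψ x := by
          rw [ENNReal.tsum_mul_left]
          conv_rhs => rw [g.Ico_eq_iUnion]
          rw [lintegral_iUnion hmeas g.pairwise_disjoint]
      _ ≤ 2 * (ENNReal.ofReal (ε / 8) + ENNReal.ofReal (ε / 8)) := by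
          rw [lintegral_add_right _ measurable_const, setLIntegral_const]
          gcongr
          · simpa only [Real.enorm_eq_ofReal_abs] using hφ
          · simp
      _ = ENNReal.ofReal (ε / 2) := by
          rw [← ENNReal.ofReal_add (by positivity) (by positivity), ← ENNReal.ofReal_ofNat 2,
            ← ENNReal.ofReal_mul (by norm_num)]
          congr 1
          ring
      _ < ENNReal.ofReal ε := (ENNReal.ofReal_lt_ofReal_iff hε).2 (by linarith)

/-! ### Lower and upper mean coincide away from zero -/

lemma lowerMean_le_upperMean (M : WeightedMean) {I : Set ℝ} {h : ℝ → ℝ} {t : ℝ}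
    (hne : ∀ ε, 0 < ε → (vicinity I (rescale h t) ε).Nonempty) :
    lowerMean M I h t ≤ upperMean M I h t := by
  refine iSup₂_le fun ε hε => le_iInf₂ fun δ hδ => ?_
  obtain ⟨g, hg⟩ := hne (min ε δ) (lt_min hε hδ)
  exact (iInf₂_le g (vicinity_mono _ _ (min_le_left _ _) hg)).trans
    (le_iSup₂_of_le g (vicinity_mono _ _ (min_le_right _ _) hg) le_rfl)

/-- Lower and upper mean of an integrable function bounded away from `0` coincide. -/
lemma lowerMean_eq_upperMean {f : ℝ → ℝ} (hmono : StrictMonoOn f (Ioi 0))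
    (hconc : ConcaveOn ℝ (Ioi 0) f) (hone : f 1 = 0) {h : ℝ → ℝ} {t a : ℝ} (ht : 0 < t)
    (hh : IntegrableOn h (Ico 0 t)) (ha0 : 0 < a) (ha : ∀ x ∈ Ico 0 t, a ≤ h x) :
    lowerMean (deviationMean (Ioi 0) fun x y => f (x / y)) (Ioi 0) h t =
      upperMean (deviationMean (Ioi 0) fun x y => f (x / y)) (Ioi 0) h t := by
  have hr := integrableOn_rescale ht hh
  have har := rescale_mem (K := Ici a) ht ha
  have har' : ∀ x ∈ Ioo (0 : ℝ) 1, a ≤ rescale h t x := fun x hx => har x (Ioo_subset_Ico_self hx)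
  have hr' : IntegrableOn (rescale h t) (Ico 0 1) :=
    (integrableOn_Ico_iff_integrableOn_Ioo (by simp)).2 hr
  have hint : ∀ y, 0 < y → IntegrableOn (fun x => f (rescale h t x / y)) (Ioo 0 1) := fun y hy =>
    integrableOn_comp_of_le hmono hconc measurableSet_Ioo (by simp) (hr.div_const y)
      (div_pos ha0 hy) fun x hx => div_le_div_of_nonneg_right (har' x hx) hy.le
  refine le_antisymm (lowerMean_le_upperMean _ fun ε hε => vicinity_nonempty hr'
    (fun x hx => ha0.trans_le (har x hx)) hε) ?_
  -- Keeps the comparison points `r < s` chosen below positive, where `f(h/r)` and `f(h/s)` make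
  -- sense.
  have hlow : ((a / 2 : ℝ) : EReal) ≤
      lowerMean (deviationMean (Ioi 0) fun x y => f (x / y)) (Ioi 0) h t := by
    refine le_lowerMean hmono hconc hone ht hh ha0 ha (by positivity) ?_
    have := setIntegral_lt_setIntegral (u := fun _ => 0) measurableSet_Ioo (by simp)
      (integrableOn_const (by simp)) (hint (a / 2) (by positivity)) fun x hx => by
        rw [← hone]
        refine hmono (mem_Ioi.2 one_pos) (div_pos (ha0.trans_le (har' x hx)) (by positivity)) ?_
        rw [one_lt_div (by positivity)]
        linarith [har' x hx]
    simpa using this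
  by_contra! hlt
  obtain ⟨r, hr1, hr2⟩ := EReal.lt_iff_exists_real_btwn.1 hlt
  obtain ⟨s, hs1, hs2⟩ := EReal.lt_iff_exists_real_btwn.1 hr2
  have hr0 : 0 < r := by
    have := hlow.trans_lt hr1
    rw [EReal.coe_lt_coe_iff] at this
    linarith
  have hrs : r < s := EReal.coe_lt_coe_iff.1 hs1
  have hs0 := hr0.trans hrs
  -- The integral is at most `0` at `r` and at least `0` at `s > r`, although it strictly decreases.
  have h1 : ∫ x in Ioo 0 1, f (rescale h t x / r) ≤ 0 := by
    by_contra! hpos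
    exact hr1.not_ge (le_lowerMean hmono hconc hone ht hh ha0 ha hr0 hpos)
  have h2 : 0 ≤ ∫ x in Ioo 0 1, f (rescale h t x / s) := by
    by_contra! hneg
    exact hs2.not_ge (upperMean_le hmono hconc hone ht hh ha0 ha hs0 hneg)
  have h3 := setIntegral_lt_setIntegral measurableSet_Ioo (by simp) (hint s hs0) (hint r hr0)
    fun x hx => strictAntiOn_div_right hmono (ha0.trans_le (har' x hx)) (mem_Ioi.2 hr0)
      (mem_Ioi.2 hs0) hrs
  linarith

/-- The closed set `closure S` misses `0`, hence misses a ball around it. -/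
lemma exists_pos_le_of_mem_deepClass {h : ℝ → ℝ} {t : ℝ} (hh : h ∈ deepClass (Ioi 0) t) :
    ∃ a, 0 < a ∧ ∀ x ∈ Ico 0 t, a ≤ h x := by
  obtain ⟨-, ⟨S, -, hS, hmem⟩, -, -⟩ := hh
  rw [interior_Ioi] at hS
  have h0 : (0 : ℝ) ∈ (closure S)ᶜ := fun h0 => lt_irrefl _ (mem_Ioi.1 (hS h0))
  obtain ⟨a, ha, hball⟩ := Metric.isOpen_iff.1 isClosed_closure.isOpen_compl 0 h0
  refine ⟨a, ha, fun x hx => ?_⟩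
  have hxS := subset_closure (hmem x hx)
  by_contra! hlt
  refine hball ?_ hxS
  rw [Metric.mem_ball, Real.dist_eq, sub_zero, abs_of_pos (mem_Ioi.1 (hS hxS))]
  exact hlt

lemma deepClass_subset_meanDomain {f : ℝ → ℝ} (hmono : StrictMonoOn f (Ioi 0))
    (hconc : ConcaveOn ℝ (Ioi 0) f) (hone : f 1 = 0) {t : ℝ} (ht : 0 < t) :
    deepClass (Ioi 0) t ⊆ meanDomain (deviationMean (Ioi 0) fun x y => f (x / y)) (Ioi 0) t := by
  intro h hh
  obtain ⟨a, ha0, ha⟩ := exists_pos_le_of_mem_deepClass hh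
  exact ⟨⟨hh.1, fun x hx => ha0.trans_le (ha x hx)⟩,
    lowerMean_eq_upperMean hmono hconc hone ht hh.1 ha0 ha⟩

/-! ### The constant defined by the vanishing integral -/

section Kernel

variable {f : ℝ → ℝ}

lemma continuousOn_one_div_comp (hconc : ConcaveOn ℝ (Ioi 0) f) :
    ContinuousOn (fun t => f (1 / t)) (Ioi 0) :=
  continuousOn_div_right hconc one_pos

lemma intervalIntegrable_one_div_comp (hmono : StrictMonoOn f (Ioi 0))
    (hconc : ConcaveOn ℝ (Ioi 0) f) (hone : f 1 = 0)
    (hfin : ∫⁻ t in Ioo (0 : ℝ) 1, ENNReal.ofReal (f (1 / t)) < ⊤) {b : ℝ} (hb : 0 < b) :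
    IntervalIntegrable (fun t => f (1 / t)) volume 0 b := by
  have hcont := continuousOn_one_div_comp hconc
  have h1 : IntegrableOn (fun t => f (1 / t)) (Ioo 0 1) := by
    refine ⟨(hcont.mono Ioo_subset_Ioi_self).aestronglyMeasurable measurableSet_Ioo, ?_⟩
    rw [hasFiniteIntegral_iff_norm]
    refine lt_of_eq_of_lt (setLIntegral_congr_fun measurableSet_Ioo fun t ht => ?_) hfin
    have : 0 ≤ f (1 / t) := by
      rw [← hone]
      exact hmono.monotoneOn (mem_Ioi.2 one_pos) (one_div_pos.2 ht.1)
        (one_le_one_div ht.1 ht.2.le)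
    simp only [Real.norm_eq_abs, abs_of_nonneg this]
  have h01 : IntervalIntegrable (fun t => f (1 / t)) volume 0 1 := by
    rwa [intervalIntegrable_iff_integrableOn_Ioo_of_le zero_le_one]
  refine h01.trans (ContinuousOn.intervalIntegrable (hcont.mono fun t ht => ?_))
  exact lt_of_lt_of_le (lt_min one_pos hb) ht.1

lemma integrableOn_one_div_mul_comp (hmono : StrictMonoOn f (Ioi 0))
    (hconc : ConcaveOn ℝ (Ioi 0) f) (hone : f 1 = 0)
    (hfin : ∫⁻ t in Ioo (0 : ℝ) 1, ENNReal.ofReal (f (1 / t)) < ⊤) {b : ℝ} (hb : 0 < b) :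
    IntegrableOn (fun s => f (1 / (b * s))) (Ioo 0 1) := by
  have := intervalIntegrable_one_div_comp hmono hconc hone hfin hb
  rw [intervalIntegrable_iff_integrableOn_Ioo_of_le hb.le] at this
  have := setIntegrable_comp_mul_left hb this
  rwa [preimage_mul_left_Ioo hb] at this

lemma integral_one_div_mul_comp (f : ℝ → ℝ) {b : ℝ} (hb : 0 < b) :
    ∫ s in Ioo 0 1, f (1 / (b * s)) = b⁻¹ * ∫ t in (0 : ℝ)..b, f (1 / t) := by
  rw [← integral_Ioc_eq_integral_Ioo, ← intervalIntegral.integral_of_le zero_le_one,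
    intervalIntegral.integral_comp_mul_left (fun t => f (1 / t)) hb.ne']
  simp

lemma integral_one_div_mul_comp_lt (hmono : StrictMonoOn f (Ioi 0))
    (hconc : ConcaveOn ℝ (Ioi 0) f) (hone : f 1 = 0)
    (hfin : ∫⁻ t in Ioo (0 : ℝ) 1, ENNReal.ofReal (f (1 / t)) < ⊤) {b c : ℝ} (hb : 0 < b)
    (hbc : b < c) : ∫ s in Ioo 0 1, f (1 / (c * s)) < ∫ s in Ioo 0 1, f (1 / (b * s)) :=
  setIntegral_lt_setIntegral measurableSet_Ioo (by simp)
    (integrableOn_one_div_mul_comp hmono hconc hone hfin (hb.trans hbc))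
    (integrableOn_one_div_mul_comp hmono hconc hone hfin hb) fun s hs =>
      hmono (one_div_pos.2 (mul_pos (hb.trans hbc) hs.1)) (one_div_pos.2 (mul_pos hb hs.1))
        (one_div_lt_one_div_of_lt (mul_pos hb hs.1) (mul_lt_mul_of_pos_right hbc hs.1))

lemma integral_one_div_comp_pos (hmono : StrictMonoOn f (Ioi 0))
    (hconc : ConcaveOn ℝ (Ioi 0) f) (hone : f 1 = 0)
    (hfin : ∫⁻ t in Ioo (0 : ℝ) 1, ENNReal.ofReal (f (1 / t)) < ⊤) :
    0 < ∫ t in (0 : ℝ)..1, f (1 / t) := by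
  have h := setIntegral_lt_setIntegral (u := fun _ => 0) measurableSet_Ioo (by simp)
    (integrableOn_const (by simp))
    (integrableOn_one_div_mul_comp hmono hconc hone hfin one_pos) fun s hs => by
      rw [← hone]
      refine hmono (mem_Ioi.2 one_pos) (one_div_pos.2 (mul_pos one_pos hs.1)) ?_
      rw [one_mul]
      exact one_lt_one_div hs.1 hs.2
  rw [integral_one_div_mul_comp f one_pos] at h
  simpa using h

lemma exists_integral_eq_zero (hmono : StrictMonoOn f (Ioi 0))
    (hconc : ConcaveOn ℝ (Ioi 0) f) (hone : f 1 = 0)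
    (hfin : ∫⁻ t in Ioo (0 : ℝ) 1, ENNReal.ofReal (f (1 / t)) < ⊤) :
    ∃ c : ℝ, 0 < c ∧ ∫ t in (0 : ℝ)..c, f (1 / t) = 0 := by
  have hint : ∀ b, 0 < b → IntervalIntegrable (fun t => f (1 / t)) volume 0 b := fun b hb =>
    intervalIntegrable_one_div_comp hmono hconc hone hfin hb
  have hhalf : f (1 / 2) < 0 := by
    rw [← hone]
    exact hmono (mem_Ioi.2 (by norm_num)) (mem_Ioi.2 one_pos) (by norm_num)
  set A := ∫ t in (0 : ℝ)..2, f (1 / t) with hA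
  -- On `[2, ∞)` the integrand is at most `f (1/2) < 0`, so `b` is far enough for the part over `[2,
  -- b]` to outweigh `A`.
  set b := 2 + |A| / (-f (1 / 2)) with hb
  have hb2 : 2 ≤ b := le_add_of_nonneg_right (div_nonneg (abs_nonneg _) (by linarith))
  have hneg : ∫ t in (0 : ℝ)..b, f (1 / t) ≤ 0 := by
    have h2b : IntervalIntegrable (fun t => f (1 / t)) volume 2 b :=
      (hint 2 two_pos).symm.trans (hint b (by linarith))
    rw [← intervalIntegral.integral_add_adjacent_intervals (hint 2 two_pos) h2b]
    have : ∫ t in (2 : ℝ)..b, f (1 / t) ≤ ∫ _ in (2 : ℝ)..b, f (1 / 2) :=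
      intervalIntegral.integral_mono_on hb2 h2b intervalIntegrable_const fun t ht =>
        hmono.monotoneOn (one_div_pos.2 (two_pos.trans_le ht.1)) (mem_Ioi.2 (by norm_num))
          (one_div_le_one_div_of_le two_pos ht.1)
    have h3 : (b - 2) * f (1 / 2) = -|A| := by
      rw [hb, add_sub_cancel_left, div_neg, neg_mul, div_mul_cancel₀ _ hhalf.ne]
    rw [intervalIntegral.integral_const, smul_eq_mul, h3] at this
    rw [← hA]
    linarith [le_abs_self A]
  have hcont : ContinuousOn (fun x => ∫ t in (0 : ℝ)..x, f (1 / t)) (Icc 1 b) := by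
    have := intervalIntegral.continuousOn_primitive_interval' (hint b (by linarith)) left_mem_uIcc
    refine this.mono ?_
    rw [uIcc_of_le (by linarith)]
    exact Icc_subset_Icc_left zero_le_one
  obtain ⟨c, hc, hc0⟩ := intermediate_value_Icc' (by linarith : (1 : ℝ) ≤ b) hcont
    ⟨hneg, (integral_one_div_comp_pos hmono hconc hone hfin).le⟩
  exact ⟨c, by linarith [hc.1], hc0⟩

/-- The primitive itself is not monotone, but its average `b⁻¹ ∫₀^b f(1/t) dt = ∫₀¹ f(1/(bs)) ds` is
strictly decreasing in `b`. -/
lemma eq_of_integral_eq_zero (hmono : StrictMonoOn f (Ioi 0))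
    (hconc : ConcaveOn ℝ (Ioi 0) f) (hone : f 1 = 0)
    (hfin : ∫⁻ t in Ioo (0 : ℝ) 1, ENNReal.ofReal (f (1 / t)) < ⊤) {b c : ℝ} (hb : 0 < b)
    (hc : 0 < c) (hb0 : ∫ t in (0 : ℝ)..b, f (1 / t) = 0)
    (hc0 : ∫ t in (0 : ℝ)..c, f (1 / t) = 0) : b = c := by
  have h1 := integral_one_div_mul_comp f hb
  have h2 := integral_one_div_mul_comp f hc
  rw [hb0, mul_zero] at h1
  rw [hc0, mul_zero] at h2
  rcases lt_trichotomy b c with h | h | h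
  · have := integral_one_div_mul_comp_lt hmono hconc hone hfin hb h
    linarith
  · exact h
  · have := integral_one_div_mul_comp_lt hmono hconc hone hfin hc h
    linarith

end Kernel

/-! ### A linear majorant of the upper mean -/

section Upper

variable {f q : ℝ → ℝ} {c : ℝ}

lemma monotoneOn_kernel (hq : AntitoneOn q (Ioi 0)) (hc : 0 < c) :
    MonotoneOn (fun s => q (1 / (c * s))) (Ioi 0) := fun _ ha _ hb hab =>
  hq (one_div_pos.2 (mul_pos hc hb)) (one_div_pos.2 (mul_pos hc ha))
    (one_div_le_one_div_of_le (mul_pos hc ha) (mul_le_mul_of_nonneg_left hab hc.le))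

lemma aemeasurable_kernel (hq : AntitoneOn q (Ioi 0)) (hc : 0 < c) :
    AEMeasurable (fun s => q (1 / (c * s))) (volume.restrict (Ioo 0 1)) :=
  aemeasurable_restrict_of_monotoneOn measurableSet_Ioo
    ((monotoneOn_kernel hq hc).mono Ioo_subset_Ioi_self)

lemma kernel_le (hq : AntitoneOn q (Ioi 0)) (hc : 0 < c) {s : ℝ} (hs : s ∈ Ioo (0 : ℝ) 1) :
    q (1 / (c * s)) ≤ q (1 / c) := by
  have := monotoneOn_kernel hq hc (mem_Ioi.2 hs.1) (mem_Ioi.2 one_pos) hs.2.le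
  simpa using this

lemma integrableOn_kernel_mul (hqpos : ∀ p, 0 < p → 0 < q p) (hq : AntitoneOn q (Ioi 0))
    (hc : 0 < c) {h : ℝ → ℝ} (hh : IntegrableOn h (Ioo 0 1)) :
    IntegrableOn (fun s => q (1 / (c * s)) * h s) (Ioo 0 1) := by
  refine Integrable.bdd_mul (c := q (1 / c)) hh (aemeasurable_kernel hq hc).aestronglyMeasurable ?_
  filter_upwards [ae_restrict_mem measurableSet_Ioo] with s hs
  rw [Real.norm_eq_abs, abs_of_pos (hqpos _ (one_div_pos.2 (mul_pos hc hs.1)))]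
  exact kernel_le hq hc hs

/-- With `p = 1/(cs)`: for `p ≥ 2` the tangent at `p`, evaluated at `1`, gives `q p * (p - 1) ≤ f
p`, whence `p * q p ≤ 2 f p`; for `p ≤ 2` boundedness of the kernel suffices. -/
lemma integrableOn_kernel_div (hmono : StrictMonoOn f (Ioi 0))
    (hconc : ConcaveOn ℝ (Ioi 0) f) (hone : f 1 = 0)
    (hqpos : ∀ p, 0 < p → 0 < q p) (hq : AntitoneOn q (Ioi 0))
    (hf : ∀ p, 0 < p → ∀ x, 0 < x → f x ≤ f p + q p * (x - p))
    (hfin : ∫⁻ t in Ioo (0 : ℝ) 1, ENNReal.ofReal (f (1 / t)) < ⊤) (hc : 0 < c) :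
    IntegrableOn (fun s => q (1 / (c * s)) * (1 / (c * s))) (Ioo 0 1) := by
  have hbd : IntegrableOn (fun s => 2 * |f (1 / (c * s))| + 2 * q (1 / c)) (Ioo 0 1) :=
    ((integrableOn_one_div_mul_comp hmono hconc hone hfin hc).abs.const_mul 2).add
      (integrableOn_const (by simp))
  refine hbd.mono' ?_ ?_
  · exact ((aemeasurable_kernel hq hc).mul
      (by fun_prop : Measurable fun s : ℝ => 1 / (c * s)).aemeasurable).aestronglyMeasurable
  · filter_upwards [ae_restrict_mem measurableSet_Ioo] with s hs
    have hp : 0 < 1 / (c * s) := one_div_pos.2 (mul_pos hc hs.1)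
    have hk := kernel_le hq hc hs
    set p := 1 / (c * s)
    have hqp := hqpos p hp
    rw [Real.norm_eq_abs, abs_of_pos (mul_pos hqp hp)]
    rcases le_total p 2 with h2 | h2
    · nlinarith [abs_nonneg (f p)]
    · have := hf p hp 1 one_pos
      rw [hone] at this
      nlinarith [le_abs_self (f p), hqpos (1 / c) (one_div_pos.2 hc)]

/-- The tangent inequality along the extremal `1 / (c s)`, integrated. -/
lemma SimpleFn.mean_mul_le (hmono : StrictMonoOn f (Ioi 0))
    (hconc : ConcaveOn ℝ (Ioi 0) f) (hone : f 1 = 0)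
    (hqpos : ∀ p, 0 < p → 0 < q p) (hq : AntitoneOn q (Ioi 0))
    (hf : ∀ p, 0 < p → ∀ x, 0 < x → f x ≤ f p + q p * (x - p))
    (hfin : ∫⁻ t in Ioo (0 : ℝ) 1, ENNReal.ofReal (f (1 / t)) < ⊤) (hc : 0 < c)
    (hc0 : ∫ t in (0 : ℝ)..c, f (1 / t) = 0) (g : SimpleFn (Ioi 0) 0 1) :
    g.mean (deviationMean (Ioi 0) fun x y => f (x / y)) *
        ∫ s in Ioo 0 1, q (1 / (c * s)) * (1 / (c * s)) ≤
      ∫ s in Ioo 0 1, q (1 / (c * s)) * g.toFun s := by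
  obtain ⟨hm, hm0⟩ := g.mean_spec hmono hconc hone
  set m := g.mean (deviationMean (Ioi 0) fun x y => f (x / y))
  have i1 := integrableOn_one_div_mul_comp hmono hconc hone hfin hc
  have i2 := integrableOn_kernel_div hmono hconc hone hqpos hq hf hfin hc
  have i3 := integrableOn_kernel_mul hqpos hq hc (g.integrableOn_comp id)
  simp only [id] at i3
  have i4 : IntegrableOn (fun s => f (1 / (c * s)) + m⁻¹ * (q (1 / (c * s)) * g.toFun s))
      (Ioo 0 1) := i1.add (i3.const_mul m⁻¹)
  have hle : ∫ s in Ioo 0 1, f (g.toFun s / m) ≤ ∫ s in Ioo 0 1,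
      (f (1 / (c * s)) + m⁻¹ * (q (1 / (c * s)) * g.toFun s) -
        q (1 / (c * s)) * (1 / (c * s))) := by
    refine setIntegral_mono_on (g.integrableOn_comp fun v => f (v / m)) (i4.sub i2) measurableSet_Ioo
      fun s hs => ?_
    refine (hf _ (one_div_pos.2 (mul_pos hc hs.1)) _
      (div_pos (g.toFun_mem (Ioo_subset_Ico_self hs)) hm)).trans_eq ?_
    ring
  rw [hm0, integral_sub i4 i2, integral_add i1 (i3.const_mul m⁻¹),
    integral_one_div_mul_comp f hc, hc0, integral_const_mul, mul_zero, zero_add, sub_nonneg] at hle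
  calc _ ≤ m * (m⁻¹ * ∫ s in Ioo 0 1, q (1 / (c * s)) * g.toFun s) :=
        mul_le_mul_of_nonneg_left hle hm.le
    _ = _ := mul_inv_cancel_left₀ hm.ne' _

lemma integral_kernel_mul_le_of_mem_vicinity (hqpos : ∀ p, 0 < p → 0 < q p)
    (hq : AntitoneOn q (Ioi 0)) (hc : 0 < c) {I : Set ℝ} {h : ℝ → ℝ}
    (hh : IntegrableOn h (Ioo 0 1)) {ε : ℝ} (hε : 0 < ε) {g : SimpleFn I 0 1}
    (hg : g ∈ vicinity I h ε) :
    ∫ s in Ioo 0 1, q (1 / (c * s)) * g.toFun s ≤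
      (∫ s in Ioo 0 1, q (1 / (c * s)) * h s) + q (1 / c) * ε := by
  have hd : IntegrableOn (fun x => h x - g.toFun x) (Ioo 0 1) := hh.sub (g.integrableOn_comp id)
  have hlt : ∫ x in Ioo 0 1, |h x - g.toFun x| ≤ ε := by
    rw [← ENNReal.ofReal_le_ofReal_iff hε.le,
      ofReal_integral_eq_lintegral_ofReal hd.abs (ae_of_all _ fun _ => abs_nonneg _)]
    exact (lintegral_mono_set Ioo_subset_Ico_self).trans hg.2.le
  have ih := integrableOn_kernel_mul hqpos hq hc hh
  have ig := integrableOn_kernel_mul hqpos hq hc (g.integrableOn_comp id)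
  have hle : ∫ s in Ioo 0 1, q (1 / (c * s)) * g.toFun s ≤ ∫ s in Ioo 0 1,
      (q (1 / (c * s)) * h s + q (1 / c) * |h s - g.toFun s|) := by
    refine setIntegral_mono_on ig (ih.add (hd.abs.const_mul _)) measurableSet_Ioo fun s hs => ?_
    have h1 := kernel_le hq hc hs
    have h2 := hqpos _ (one_div_pos.2 (mul_pos hc hs.1))
    have h3 : g.toFun s ≤ h s + |h s - g.toFun s| := by linarith [neg_abs_le (h s - g.toFun s)]
    nlinarith [mul_le_mul_of_nonneg_left h3 h2.le,
      mul_le_mul_of_nonneg_right h1 (abs_nonneg (h s - g.toFun s))]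
  rw [integral_add ih (hd.abs.const_mul _), integral_const_mul] at hle
  exact hle.trans (add_le_add_right (mul_le_mul_of_nonneg_left hlt
    (hqpos _ (one_div_pos.2 hc)).le) _)

lemma integral_kernel_div_pos (hqpos : ∀ p, 0 < p → 0 < q p) (hc : 0 < c)
    (hi : IntegrableOn (fun s => q (1 / (c * s)) * (1 / (c * s))) (Ioo 0 1)) :
    0 < ∫ s in Ioo 0 1, q (1 / (c * s)) * (1 / (c * s)) := by
  have := setIntegral_lt_setIntegral (u := fun _ => 0) measurableSet_Ioo (by simp)
    (integrableOn_const (by simp)) hi fun s hs => by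
      have hp := one_div_pos.2 (mul_pos hc hs.1)
      exact mul_pos (hqpos _ hp) hp
  simpa using this

/-- The upper mean is dominated by a linear functional. -/
lemma upperMean_le_integral_kernel (hmono : StrictMonoOn f (Ioi 0))
    (hconc : ConcaveOn ℝ (Ioi 0) f) (hone : f 1 = 0)
    (hqpos : ∀ p, 0 < p → 0 < q p) (hq : AntitoneOn q (Ioi 0))
    (hf : ∀ p, 0 < p → ∀ x, 0 < x → f x ≤ f p + q p * (x - p))
    (hfin : ∫⁻ t in Ioo (0 : ℝ) 1, ENNReal.ofReal (f (1 / t)) < ⊤) (hc : 0 < c)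
    (hc0 : ∫ t in (0 : ℝ)..c, f (1 / t) = 0) {u : ℝ → ℝ} {t : ℝ} (ht : 0 < t)
    (hu : IntegrableOn u (Ico 0 t)) :
    upperMean (deviationMean (Ioi 0) fun x y => f (x / y)) (Ioi 0) u t ≤
      (((∫ s in Ioo 0 1, q (1 / (c * s)) * u (t * s)) /
        ∫ s in Ioo 0 1, q (1 / (c * s)) * (1 / (c * s)) : ℝ) : EReal) := by
  have hK := integral_kernel_div_pos hqpos hc
    (integrableOn_kernel_div hmono hconc hone hqpos hq hf hfin hc)
  by_contra! hlt
  obtain ⟨r, hr1, hr2⟩ := EReal.lt_iff_exists_real_btwn.1 hlt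
  rw [EReal.coe_lt_coe_iff, div_lt_iff₀ hK] at hr1
  set K := ∫ s in Ioo 0 1, q (1 / (c * s)) * (1 / (c * s)) with hKdef
  set A := ∫ s in Ioo 0 1, q (1 / (c * s)) * u (t * s) with hA
  have hq1 := hqpos (1 / c) (one_div_pos.2 hc)
  -- With this radius the approximation error `q (1/c) * ε` equals the slack `r * K - A`.
  have hε : 0 < (r * K - A) / q (1 / c) := div_pos (by linarith) hq1
  refine hr2.not_ge (iInf₂_le_of_le _ hε (iSup₂_le fun g hg => EReal.coe_le_coe_iff.2 ?_))
  have h1 := g.mean_mul_le hmono hconc hone hqpos hq hf hfin hc hc0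
  have h2 := integral_kernel_mul_le_of_mem_vicinity hqpos hq hc (integrableOn_rescale ht hu) hε hg
  rw [mul_div_cancel₀ _ hq1.ne'] at h2
  simp only [rescale] at h2
  rw [← hA] at h2
  refine le_of_mul_le_mul_right (a := K) ?_ hK
  linarith

end Upper

/-! ### The Hardy inequality by Tonelli and dilation -/

/-- After exchanging the integrals, the substitution `t ↦ ts` gives the factor `s⁻¹`. For Tonelli,
`v` is first replaced by a measurable representative, which is harmless because dilations preserve
null sets. -/
lemma lintegral_lintegral_kernel_mul {k v : ℝ → ℝ≥0∞}
    (hk : AEMeasurable k (volume.restrict (Ioo 0 1)))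
    (hv : AEMeasurable v (volume.restrict (Ioi 0))) :
    ∫⁻ t in Ioi 0, ∫⁻ s in Ioo 0 1, k s * v (t * s) =
      (∫⁻ s in Ioo 0 1, k s * ENNReal.ofReal s⁻¹) * ∫⁻ t in Ioi 0, v t := by
  have hvm := hv.measurable_mk
  have hae : ∀ᵐ x ∂volume, x ∈ Ioi 0 → v x = hv.mk v x :=
    (ae_restrict_iff' measurableSet_Ioi).1 hv.ae_eq_mk
  have h1 : ∀ t ∈ Ioi (0 : ℝ), ∫⁻ s in Ioo 0 1, k s * v (t * s) =
      ∫⁻ s in Ioo 0 1, k s * hv.mk v (t * s) := by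
    intro t ht
    have he := measurableEmbedding_mulLeft₀ (mem_Ioi.1 ht).ne'
    have hae' : ∀ᵐ x ∂(volume.map fun x => t * x), x ∈ Ioi 0 → v x = hv.mk v x := by
      rw [Real.map_volume_mul_left (mem_Ioi.1 ht).ne']
      exact Measure.ae_smul_measure hae _
    refine lintegral_congr_ae ?_
    filter_upwards [ae_restrict_of_ae (he.ae_map_iff.1 hae'), ae_restrict_mem measurableSet_Ioo]
      with s hs hs'
    rw [hs (mul_pos ht hs'.1)]
  rw [setLIntegral_congr_fun measurableSet_Ioi h1, lintegral_lintegral_swap]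
  · rw [lintegral_congr_ae hv.ae_eq_mk]
    have hm : AEMeasurable (fun s => k s * ENNReal.ofReal s⁻¹) (volume.restrict (Ioo 0 1)) :=
      hk.mul measurable_inv.ennreal_ofReal.aemeasurable
    rw [← lintegral_mul_const'' _ hm]
    refine setLIntegral_congr_fun measurableSet_Ioo fun s hs => ?_
    have h2 := setLIntegral_comp_mul_left hs.1 (Ioi 0) (hv.mk v)
    rw [preimage_mul_left_Ioi hs.1] at h2
    rw [lintegral_const_mul _ (by fun_prop), mul_assoc, ← h2]
    simp only [mul_comm]
  · exact (hk.comp_snd).mul (hvm.comp measurable_mul).aemeasurable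

/-- The integral Hardy inequality with constant `c`. -/
lemma lintegral_integralMean_le {f : ℝ → ℝ} (hmono : StrictMonoOn f (Ioi 0))
    (hconc : ConcaveOn ℝ (Ioi 0) f) (hone : f 1 = 0)
    (hfin : ∫⁻ t in Ioo (0 : ℝ) 1, ENNReal.ofReal (f (1 / t)) < ⊤) {c : ℝ} (hc : 0 < c)
    (hc0 : ∫ t in (0 : ℝ)..c, f (1 / t) = 0) {u : ℝ → ℝ} (hpos : ∀ t, 0 ≤ t → 0 < u t)
    (hu : IntegrableOn u (Ici 0))
    (hdom : ∀ t, 0 < t → u ∈ meanDomain (deviationMean (Ioi 0) fun x y => f (x / y)) (Ioi 0) t) :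
    ∫⁻ t in Ioi 0,
        (integralMean (deviationMean (Ioi 0) fun x y => f (x / y)) (Ioi 0) u t).toENNReal ≤
      ENNReal.ofReal c * ∫⁻ t in Ioi 0, ENNReal.ofReal (u t) := by
  obtain ⟨q, hqpos, hq, hf⟩ := exists_supergradient hmono hconc
  have hi := integrableOn_kernel_div hmono hconc hone hqpos hq hf hfin hc
  have hK := integral_kernel_div_pos hqpos hc hi
  set K := ∫ s in Ioo 0 1, q (1 / (c * s)) * (1 / (c * s)) with hKdef
  have hk := (aemeasurable_kernel hq hc).ennreal_ofReal
  have hqs : ∀ s ∈ Ioo (0 : ℝ) 1, 0 < q (1 / (c * s)) := fun s hs =>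
    hqpos _ (one_div_pos.2 (mul_pos hc hs.1))
  have hle : ∀ t ∈ Ioi (0 : ℝ),
      (integralMean (deviationMean (Ioi 0) fun x y => f (x / y)) (Ioi 0) u t).toENNReal ≤
        ENNReal.ofReal K⁻¹ *
          ∫⁻ s in Ioo 0 1, ENNReal.ofReal (q (1 / (c * s))) * ENNReal.ofReal (u (t * s)) := by
    intro t ht
    have hut := hu.mono_set (Ico_subset_Ici_self : Ico 0 t ⊆ Ici 0)
    have h1 := upperMean_le_integral_kernel hmono hconc hone hqpos hq hf hfin hc hc0 ht hut
    have h2 : IntegrableOn (fun s => q (1 / (c * s)) * u (t * s)) (Ioo 0 1) :=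
      integrableOn_kernel_mul hqpos hq hc (integrableOn_rescale ht hut)
    rw [integralMean, (hdom t ht).2]
    refine (EReal.toENNReal_le_toENNReal h1).trans_eq ?_
    rw [EReal.toENNReal_of_ne_top (EReal.coe_ne_top _), EReal.toReal_coe, div_eq_inv_mul,
      ENNReal.ofReal_mul (inv_pos.2 hK).le, ofReal_integral_eq_lintegral_ofReal h2]
    · congr 1
      refine setLIntegral_congr_fun measurableSet_Ioo fun s hs => ?_
      exact ENNReal.ofReal_mul (hqs s hs).le
    · filter_upwards [ae_restrict_mem measurableSet_Ioo] with s hs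
      exact (mul_pos (hqs s hs) (hpos _ (mul_pos ht hs.1).le)).le
  have hkc : ∫⁻ s in Ioo 0 1, ENNReal.ofReal (q (1 / (c * s))) * ENNReal.ofReal s⁻¹ =
      ENNReal.ofReal (c * K) := by
    rw [hKdef, ← integral_const_mul, ofReal_integral_eq_lintegral_ofReal (hi.const_mul c)]
    · refine setLIntegral_congr_fun measurableSet_Ioo fun s hs => ?_
      rw [← ENNReal.ofReal_mul (hqs s hs).le]
      congr 1
      have := hs.1.ne'
      field_simp
    · filter_upwards [ae_restrict_mem measurableSet_Ioo] with s hs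
      exact (mul_pos hc (mul_pos (hqs s hs) (one_div_pos.2 (mul_pos hc hs.1)))).le
  calc _ ≤ ∫⁻ t in Ioi 0, ENNReal.ofReal K⁻¹ *
          ∫⁻ s in Ioo 0 1, ENNReal.ofReal (q (1 / (c * s))) * ENNReal.ofReal (u (t * s)) :=
        setLIntegral_mono' measurableSet_Ioi hle
    _ = ENNReal.ofReal K⁻¹ * (ENNReal.ofReal (c * K) * ∫⁻ t in Ioi 0, ENNReal.ofReal (u t)) := by
        rw [lintegral_const_mul' _ _ ENNReal.ofReal_ne_top, lintegral_lintegral_kernel_mul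
          (v := fun x => ENNReal.ofReal (u x)) hk
          (hu.mono_set Ioi_subset_Ici_self).aemeasurable.ennreal_ofReal, hkc]
    _ = ENNReal.ofReal c * ∫⁻ t in Ioi 0, ENNReal.ofReal (u t) := by
        rw [← mul_assoc, ← ENNReal.ofReal_mul (inv_pos.2 hK).le]
        congr 2
        field_simp

/-! ### Positive continuous functions belong to the deep class -/

/-- Exceptional points in `(0, t)` form an open null set, hence none exist; closedness then recovers
the endpoint `0`. It identifies essential with true bounds for continuous functions. -/
lemma mem_of_ae_mem_of_isClosed {Y : Type*} [TopologicalSpace Y] {φ : ℝ → Y} (hφ : Continuous φ)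
    {F : Set Y} (hF : IsClosed F) {t : ℝ} (h : ∀ᵐ x ∂volume.restrict (Ico 0 t), φ x ∈ F) :
    ∀ x ∈ Ico 0 t, φ x ∈ F := by
  have hopen : IsOpen (φ ⁻¹' Fᶜ ∩ Ioo 0 t) := (hF.isOpen_compl.preimage hφ).inter isOpen_Ioo
  have hnull : volume (φ ⁻¹' Fᶜ ∩ Ioo 0 t) = 0 := by
    refine measure_mono_null ?_ (ae_iff.1 ((ae_restrict_iff' measurableSet_Ico).1 h))
    exact fun x hx hx' => hx.1 (hx' (Ioo_subset_Ico_self hx.2))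
  rw [hopen.measure_eq_zero_iff volume] at hnull
  have hsub : Ioo 0 t ⊆ φ ⁻¹' F := fun x hx => by
    by_contra hxF
    exact (hnull ▸ (⟨hxF, hx⟩ : x ∈ φ ⁻¹' Fᶜ ∩ Ioo 0 t) : x ∈ (∅ : Set ℝ))
  intro x hx
  have h0t : (0 : ℝ) ≠ t := (hx.1.trans_lt hx.2).ne
  have := closure_minimal hsub (hF.preimage hφ)
  rw [closure_Ioo h0t] at this
  exact this (Ico_subset_Icc_self hx)

lemma continuous_mem_deepClass {u : ℝ → ℝ} (hu : Continuous u) (hpos : ∀ t, 0 < u t) (t : ℝ) :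
    u ∈ deepClass (Ioi 0) t := by
  have huE : Continuous fun x => (u x : EReal) := continuous_coe_real_ereal.comp hu
  refine ⟨(hu.integrableOn_Icc).mono_set Ico_subset_Icc_self,
    ⟨u '' Icc 0 t, ?_, ?_, fun x hx => mem_image_of_mem u (Ico_subset_Icc_self hx)⟩, ?_, ?_⟩
  · exact (isPreconnected_Icc.image u hu.continuousOn).ordConnected
  · rw [(isCompact_Icc.image hu).isClosed.closure_eq, interior_Ioi]
    rintro _ ⟨x, -, rfl⟩
    exact hpos x
  · refine le_antisymm (essSup_le_of_ae_le _ ?_) (iSup₂_le ?_)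
    · filter_upwards [ae_restrict_mem measurableSet_Ico] with x hx
      exact le_iSup₂_of_le x hx le_rfl
    · exact mem_of_ae_mem_of_isClosed huE isClosed_Iic
        (ae_le_essSup (f := fun x => (u x : EReal)) (μ := volume.restrict (Ico 0 t)))
  · refine le_antisymm (le_iInf₂ ?_) (le_essInf_of_ae_le _ ?_)
    · exact mem_of_ae_mem_of_isClosed huE isClosed_Ici
        (ae_essInf_le (f := fun x => (u x : EReal)) (μ := volume.restrict (Ico 0 t)))
    · filter_upwards [ae_restrict_mem measurableSet_Ico] with x hx
      exact iInf₂_le_of_le x hx le_rfl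

/-! ### Truncations and test functions for the lower bound -/

section Lower

variable {f : ℝ → ℝ} {y : ℝ}

lemma integrableOn_truncation (hmono : StrictMonoOn f (Ioi 0))
    (hconc : ConcaveOn ℝ (Ioi 0) f) (hy : 0 < y) {δ : ℝ} (hδ : 0 < δ) :
    IntegrableOn (fun s => f (1 / (y * max s δ))) (Ioo 0 1) := by
  have hm : ∀ s, 0 < y * max s δ := fun s => mul_pos hy (lt_max_of_lt_right hδ)
  have hcont : Continuous fun s => 1 / (y * max s δ) :=
    continuous_const.div (by fun_prop) fun s => (hm s).ne'
  refine integrableOn_comp_of_le hmono hconc measurableSet_Ioo (by simp)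
    (hcont.integrableOn_Icc.mono_set Ioo_subset_Icc_self) (one_div_pos.2 (hm 1)) fun s hs => ?_
  exact one_div_le_one_div_of_le (hm s)
    (mul_le_mul_of_nonneg_left (max_le_max_right _ hs.2.le) hy.le)

/-- If the integral of `f (1 / (y s))` is positive, then so is that of some truncation. -/
lemma exists_truncation_pos (hmono : StrictMonoOn f (Ioi 0))
    (hconc : ConcaveOn ℝ (Ioi 0) f) (hy : 0 < y)
    (h : ENNReal.ofReal (-f (1 / y)) <
      ∫⁻ s in Ioo (0 : ℝ) 1, ENNReal.ofReal (f (1 / (y * s)) - f (1 / y))) :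
    ∃ δ, 0 < δ ∧ δ ≤ 1 ∧ 0 < ∫ s in Ioo 0 1, f (1 / (y * max s δ)) := by
  have hδ : ∀ n : ℕ, (0 : ℝ) < 1 / (n + 1) := fun n => Nat.one_div_pos_of_nat
  have hδ1 : ∀ n : ℕ, (1 : ℝ) / (n + 1) ≤ 1 := fun n => by
    rw [div_le_one (by positivity)]
    linarith [(Nat.cast_nonneg n : (0 : ℝ) ≤ n)]
  have hm : ∀ (n : ℕ) s, 0 < y * max s (1 / ((n : ℝ) + 1)) := fun n s =>
    mul_pos hy (lt_max_of_lt_right (hδ n))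
  -- Subtracting `f (1/y)`, a lower bound of the integrand on `(0, 1)`, makes everything
  -- nonnegative, so monotone convergence applies as the truncation level `1/(n+1)` decreases.
  have hlim := lintegral_tendsto_of_tendsto_of_monotone (μ := volume.restrict (Ioo (0 : ℝ) 1))
    (f := fun (n : ℕ) s => ENNReal.ofReal (f (1 / (y * max s (1 / (n + 1)))) - f (1 / y)))
    (F := fun s => ENNReal.ofReal (f (1 / (y * s)) - f (1 / y)))
    (fun n => ((integrableOn_truncation hmono hconc hy (hδ n)).aemeasurable.sub_const
      _).ennreal_ofReal)
    (ae_of_all _ fun s m n hmn => by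
      refine ENNReal.ofReal_le_ofReal (sub_le_sub_right ?_ _)
      exact hmono.monotoneOn (one_div_pos.2 (hm m s)) (one_div_pos.2 (hm n s))
        (one_div_le_one_div_of_le (hm n s) (mul_le_mul_of_nonneg_left
          (max_le_max_left _ (Nat.one_div_le_one_div hmn)) hy.le)))
    (by
      filter_upwards [ae_restrict_mem measurableSet_Ioo] with s hs
      refine tendsto_const_nhds.congr' ?_
      filter_upwards [tendsto_one_div_add_atTop_nhds_zero_nat.eventually (gt_mem_nhds hs.1)]
        with n hn
      rw [max_eq_left hn.le])
  obtain ⟨n, hn⟩ := (hlim.eventually (lt_mem_nhds h)).exists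
  refine ⟨1 / (n + 1), hδ n, hδ1 n, ?_⟩
  have hi := integrableOn_truncation hmono hconc hy (hδ n)
  have hc : IntegrableOn (fun _ : ℝ => f (1 / y)) (Ioo 0 1) := integrableOn_const (by simp)
  have hd : IntegrableOn (fun s => f (1 / (y * max s (1 / ((n : ℝ) + 1)))) - f (1 / y)) (Ioo 0 1) :=
    hi.sub hc
  rw [← ofReal_integral_eq_lintegral_ofReal hd] at hn
  · have := (ENNReal.ofReal_lt_ofReal_iff').1 hn
    rw [integral_sub hi hc] at this
    simp at this
    simpa using this.1
  · filter_upwards [ae_restrict_mem measurableSet_Ioo] with s hs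
    refine sub_nonneg.2 (hmono.monotoneOn (one_div_pos.2 hy) (one_div_pos.2 (hm n s))
      (one_div_le_one_div_of_le (hm n s) ?_))
    exact mul_le_of_le_one_right hy.le (max_le hs.2.le (hδ1 n))

lemma exists_truncation_pos_of_integral_pos (hmono : StrictMonoOn f (Ioi 0))
    (hconc : ConcaveOn ℝ (Ioi 0) f) (hone : f 1 = 0)
    (hfin : ∫⁻ t in Ioo (0 : ℝ) 1, ENNReal.ofReal (f (1 / t)) < ⊤) (hy : 1 ≤ y)
    (hpos : 0 < ∫ s in Ioo 0 1, f (1 / (y * s))) :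
    ∃ δ, 0 < δ ∧ δ ≤ 1 ∧ 0 < ∫ s in Ioo 0 1, f (1 / (y * max s δ)) := by
  have hy0 : 0 < y := one_pos.trans_le hy
  refine exists_truncation_pos hmono hconc hy0 ?_
  have hi := integrableOn_one_div_mul_comp hmono hconc hone hfin hy0
  have hc : IntegrableOn (fun _ : ℝ => f (1 / y)) (Ioo 0 1) := integrableOn_const (by simp)
  have hfy : f (1 / y) ≤ 0 := by
    rw [← hone]
    exact hmono.monotoneOn (one_div_pos.2 hy0) (mem_Ioi.2 one_pos) ((div_le_one hy0).2 hy)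
  have hd : IntegrableOn (fun s => f (1 / (y * s)) - f (1 / y)) (Ioo 0 1) := hi.sub hc
  rw [← ofReal_integral_eq_lintegral_ofReal hd, ENNReal.ofReal_lt_ofReal_iff',
    integral_sub hi hc]
  · simp only [integral_const, measureReal_restrict_apply_univ, Real.volume_real_Ioo_of_le zero_le_one]
    simp only [sub_zero, one_smul]
    exact ⟨by linarith, by linarith⟩
  · filter_upwards [ae_restrict_mem measurableSet_Ioo] with s hs
    exact sub_nonneg.2 (hmono.monotoneOn (one_div_pos.2 hy0) (one_div_pos.2 (mul_pos hy0 hs.1))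
      (one_div_le_one_div_of_le (mul_pos hy0 hs.1) (mul_le_of_le_one_right hy0.le hs.2.le)))

lemma exists_truncation_pos_of_lintegral_eq_top (hmono : StrictMonoOn f (Ioi 0))
    (hconc : ConcaveOn ℝ (Ioi 0) f) (hone : f 1 = 0)
    (htop : ∫⁻ t in Ioo (0 : ℝ) 1, ENNReal.ofReal (f (1 / t)) = ⊤) (hy : 1 ≤ y) :
    ∃ δ, 0 < δ ∧ δ ≤ 1 ∧ 0 < ∫ s in Ioo 0 1, f (1 / (y * max s δ)) := by
  have hy0 : 0 < y := one_pos.trans_le hy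
  refine exists_truncation_pos hmono hconc hy0 ?_
  have hfy : f (1 / y) ≤ 0 := by
    rw [← hone]
    exact hmono.monotoneOn (one_div_pos.2 hy0) (mem_Ioi.2 one_pos) ((div_le_one hy0).2 hy)
  have h1 := setLIntegral_comp_mul_left hy0 (Ioo 0 y)
    fun t => ENNReal.ofReal (f (1 / t) - f (1 / y))
  rw [preimage_mul_left_Ioo hy0] at h1
  have h2 : ∫⁻ t in Ioo (0 : ℝ) y, ENNReal.ofReal (f (1 / t) - f (1 / y)) = ⊤ := by
    -- Because `f (1/y) ≤ 0`, subtracting it can only enlarge the integrand.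
    refine top_le_iff.1 (htop.symm.trans_le ?_)
    exact (lintegral_mono fun t => ENNReal.ofReal_le_ofReal (by linarith)).trans
      (lintegral_mono_set (Ioo_subset_Ioo_right hy))
  rw [h1, h2, ENNReal.mul_top (by simpa using hy0)]
  exact ENNReal.ofReal_lt_top

/-- A continuous integrable modification of `1 / s`, equal to it on `[1, T]`. -/
def truncatedInv (T s : ℝ) : ℝ := T / (max s 1 * max s T)

lemma truncatedInv_pos {T : ℝ} (hT : 1 ≤ T) (s : ℝ) : 0 < truncatedInv T s :=
  div_pos (by linarith) (mul_pos (lt_max_of_lt_right one_pos) (lt_max_of_lt_right (by linarith)))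

lemma continuous_truncatedInv {T : ℝ} (hT : 1 ≤ T) : Continuous (truncatedInv T) :=
  continuous_const.div (by fun_prop) fun s => (mul_pos (lt_max_of_lt_right one_pos)
    (lt_max_of_lt_right (by linarith : 0 < T))).ne'

lemma truncatedInv_of_le {T s : ℝ} (hT : 1 ≤ T) (hs : s ≤ T) :
    truncatedInv T s = 1 / max s 1 := by
  have : T ≠ 0 := by linarith
  have : max s 1 ≠ 0 := (lt_max_of_lt_right one_pos).ne'
  rw [truncatedInv, max_eq_right hs]
  field_simp

/-- The pieces `(0,1]`, `(1,T]` and `(T,∞)` contribute at most `1`, `log T` and `1`. -/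
lemma lintegral_truncatedInv_le {T : ℝ} (hT : 1 ≤ T) :
    ∫⁻ s in Ioi 0, ENNReal.ofReal (truncatedInv T s) ≤ ENNReal.ofReal (Real.log T + 2) := by
  have hT0 : 0 < T := by linarith
  have h1 : ∫⁻ s in Ioc 0 1, ENNReal.ofReal (truncatedInv T s) ≤ ENNReal.ofReal 1 := by
    calc _ ≤ ∫⁻ _ in Ioc (0 : ℝ) 1, ENNReal.ofReal 1 :=
          setLIntegral_mono' measurableSet_Ioc fun s hs => ENNReal.ofReal_le_ofReal (by
            rw [truncatedInv_of_le hT (hs.2.trans hT), max_eq_right hs.2, div_one])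
      _ = _ := by simp
  have h2 : ∫⁻ s in Ioc 1 T, ENNReal.ofReal (truncatedInv T s) ≤
      ENNReal.ofReal (Real.log T) := by
    have hi : IntervalIntegrable (fun s : ℝ => 1 / s) volume 1 T :=
      intervalIntegral.intervalIntegrable_one_div (fun s hs => by
        rw [uIcc_of_le hT] at hs
        linarith [hs.1]) continuousOn_id
    refine le_of_eq ?_
    calc _ = ∫⁻ s in Ioc 1 T, ENNReal.ofReal (1 / s) :=
          setLIntegral_congr_fun measurableSet_Ioc fun s hs => by
            simp only [truncatedInv_of_le hT hs.2, max_eq_left hs.1.le]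
      _ = ENNReal.ofReal (∫ s in Ioc 1 T, 1 / s) := by
          refine (ofReal_integral_eq_lintegral_ofReal
            ((intervalIntegrable_iff_integrableOn_Ioc_of_le hT).1 hi) ?_).symm
          filter_upwards [ae_restrict_mem measurableSet_Ioc] with s hs
          exact one_div_nonneg.2 (by linarith [hs.1])
      _ = ENNReal.ofReal (Real.log T) := by
          rw [← intervalIntegral.integral_of_le hT, integral_one_div_of_pos one_pos hT0, div_one]
  have h3 : ∫⁻ s in Ioi T, ENNReal.ofReal (truncatedInv T s) ≤ ENNReal.ofReal 1 := by
    have hi := (integrableOn_Ioi_rpow_of_lt (by norm_num : (-2 : ℝ) < -1) hT0).const_mul T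
    refine le_of_eq ?_
    calc _ = ∫⁻ s in Ioi T, ENNReal.ofReal (T * s ^ (-2 : ℝ)) :=
          setLIntegral_congr_fun measurableSet_Ioi fun s hs => by
            have hs' : T < s := hs
            have hs0 : 0 < s := hT0.trans hs'
            rw [truncatedInv, max_eq_left (hT.trans hs'.le), max_eq_left hs'.le,
              Real.rpow_neg hs0.le, Real.rpow_two, div_eq_mul_inv, sq]
      _ = ENNReal.ofReal (∫ s in Ioi T, T * s ^ (-2 : ℝ)) := by
          refine (ofReal_integral_eq_lintegral_ofReal hi ?_).symm
          filter_upwards [ae_restrict_mem measurableSet_Ioi] with s hs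
          exact mul_nonneg hT0.le (Real.rpow_nonneg (hT0.trans hs).le _)
      _ = ENNReal.ofReal 1 := by
          rw [integral_const_mul, integral_Ioi_rpow_of_lt (by norm_num) hT0]
          norm_num
          rw [Real.rpow_neg_one, mul_inv_cancel₀ hT0.ne']
  rw [← Ioc_union_Ioi_eq_Ioi (zero_le_one.trans hT), ← Ioc_union_Ioc_eq_Ioc zero_le_one hT]
  refine (lintegral_union_le _ _ _).trans ((add_le_add_left (lintegral_union_le _ _ _) _).trans
    ((add_le_add (add_le_add h1 h2) h3).trans_eq ?_))
  rw [← ENNReal.ofReal_add zero_le_one (Real.log_nonneg hT),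
    ← ENNReal.ofReal_add (add_nonneg zero_le_one (Real.log_nonneg hT)) zero_le_one]
  congr 1
  ring

lemma integrableOn_truncatedInv {T : ℝ} (hT : 1 ≤ T) : IntegrableOn (truncatedInv T) (Ici 0) := by
  rw [integrableOn_Ici_iff_integrableOn_Ioi (by simp)]
  refine ⟨(continuous_truncatedInv hT).aestronglyMeasurable, ?_⟩
  rw [hasFiniteIntegral_iff_norm]
  refine lt_of_le_of_lt ?_ ((lintegral_truncatedInv_le hT).trans_lt ENNReal.ofReal_lt_top)
  refine lintegral_mono fun s => ?_
  rw [Real.norm_eq_abs, abs_of_pos (truncatedInv_pos hT s)]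

/-- The integral mean of the modified `1 / s` over `[0, t)` is at least `y / t`. -/
lemma le_integralMean_truncatedInv (hmono : StrictMonoOn f (Ioi 0))
    (hconc : ConcaveOn ℝ (Ioi 0) f) (hone : f 1 = 0) (hy : 0 < y) {δ : ℝ} (hδ : 0 < δ)
    (hpos : 0 < ∫ s in Ioo 0 1, f (1 / (y * max s δ))) {T t : ℝ} (hT : 1 ≤ T) (hδt : 1 / δ ≤ t)
    (htT : t ≤ T) : ((y / t : ℝ) : EReal) ≤
      integralMean (deviationMean (Ioi 0) fun x y => f (x / y)) (Ioi 0) (truncatedInv T) t := by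
  have ht : 0 < t := (one_div_pos.2 hδ).trans_le hδt
  have ht' : 1 / t ≤ δ := by rwa [one_div_le ht hδ]
  -- By homogeneity, averaging over `[0, t)` amounts to truncating `1/(ys)` at level `1/t ≤ δ`,
  -- which only raises the integrand compared with level `δ`.
  have hr : ∀ s ∈ Ico (0 : ℝ) 1, rescale (truncatedInv T) t s / (y / t) =
      1 / (y * max s (1 / t)) := by
    intro s hs
    rw [rescale, truncatedInv_of_le hT ((mul_le_of_le_one_right ht.le hs.2.le).trans htT)]
    have : max (t * s) 1 = t * max s (1 / t) := by
      rw [mul_max_of_nonneg _ _ ht.le, mul_one_div_cancel ht.ne']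
    rw [this]
    have h1 : max s (1 / t) ≠ 0 := (lt_max_of_lt_right (one_div_pos.2 ht)).ne'
    field_simp
  refine le_lowerMean hmono hconc hone (a := 1 / max t 1) ht
    ((integrableOn_truncatedInv hT).mono_set Ico_subset_Ici_self)
    (one_div_pos.2 (lt_max_of_lt_right one_pos)) (fun x hx => ?_) (div_pos hy ht) ?_
  · rw [truncatedInv_of_le hT (hx.2.le.trans htT)]
    exact one_div_le_one_div_of_le (lt_max_of_lt_right one_pos) (max_le_max_right _ hx.2.le)
  · rw [setIntegral_congr_fun (g := fun s => f (1 / (y * max s (1 / t)))) measurableSet_Ioo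
      fun s hs => by simp only [hr s (Ioo_subset_Ico_self hs)]]
    refine hpos.trans_le (setIntegral_mono_on (integrableOn_truncation hmono hconc hy hδ)
      (integrableOn_truncation hmono hconc hy (one_div_pos.2 ht)) measurableSet_Ioo fun s _ => ?_)
    have h1 : 0 < y * max s δ := mul_pos hy (lt_max_of_lt_right hδ)
    have h2 : 0 < y * max s (1 / t) := mul_pos hy (lt_max_of_lt_right (one_div_pos.2 ht))
    exact hmono.monotoneOn (one_div_pos.2 h1) (one_div_pos.2 h2) (one_div_le_one_div_of_le h2
      (mul_le_mul_of_nonneg_left (max_le_max_left _ ht') hy.le))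

lemma ofReal_mul_log_le_lintegral (hmono : StrictMonoOn f (Ioi 0))
    (hconc : ConcaveOn ℝ (Ioi 0) f) (hone : f 1 = 0) (hy : 0 < y) {δ : ℝ} (hδ : 0 < δ)
    (hpos : 0 < ∫ s in Ioo 0 1, f (1 / (y * max s δ))) {T : ℝ} (hT : 1 ≤ T) (hδT : 1 / δ ≤ T) :
    ENNReal.ofReal (y * Real.log (T / (1 / δ))) ≤ ∫⁻ t in Ioi 0,
      (integralMean (deviationMean (Ioi 0) fun x y => f (x / y)) (Ioi 0)
        (truncatedInv T) t).toENNReal := by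
  have hδ' := one_div_pos.2 hδ
  have hi : IntervalIntegrable (fun s : ℝ => 1 / s) volume (1 / δ) T :=
    intervalIntegral.intervalIntegrable_one_div (fun s hs => by
      rw [uIcc_of_le hδT] at hs
      exact (hδ'.trans_le hs.1).ne') continuousOn_id
  calc ENNReal.ofReal (y * Real.log (T / (1 / δ)))
      = ENNReal.ofReal (∫ t in Ioc (1 / δ) T, y * (1 / t)) := by
        rw [integral_const_mul, ← intervalIntegral.integral_of_le hδT,
          integral_one_div_of_pos hδ' (by linarith)]
    _ = ∫⁻ t in Ioc (1 / δ) T, ENNReal.ofReal (y * (1 / t)) := by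
        refine ofReal_integral_eq_lintegral_ofReal
          (((intervalIntegrable_iff_integrableOn_Ioc_of_le hδT).1 hi).const_mul y) ?_
        filter_upwards [ae_restrict_mem measurableSet_Ioc] with s hs
        exact mul_nonneg hy.le (one_div_nonneg.2 (hδ'.trans hs.1).le)
    _ ≤ ∫⁻ t in Ioc (1 / δ) T, (integralMean (deviationMean (Ioi 0) fun x y => f (x / y)) (Ioi 0)
          (truncatedInv T) t).toENNReal := by
        refine setLIntegral_mono' measurableSet_Ioc fun t ht => ?_
        have := EReal.toENNReal_le_toENNReal
          (le_integralMean_truncatedInv hmono hconc hone hy hδ hpos hT ht.1.le ht.2)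
        rwa [EReal.toENNReal_of_ne_top (EReal.coe_ne_top _), EReal.toReal_coe,
          div_eq_mul_one_div] at this
    _ ≤ _ := lintegral_mono_set fun t ht => hδ'.trans ht.1

end Lower

/-! ### Evaluation of the Hardy constant -/

/-- A linear bound between affine functions that is valid for all large arguments bounds the slope. -/
lemma le_of_forall_mul_le {y C d : ℝ} (hC : 0 ≤ C) (hd : 0 ≤ d)
    (h : ∀ x, 0 ≤ x → y * x ≤ C * (d + x + 2)) : y ≤ C := by
  by_contra! hlt
  have hyC : 0 < y - C := sub_pos.2 hlt
  have := h ((C * (d + 2) + 1) / (y - C)) (by positivity)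
  have h2 : (y - C) * ((C * (d + 2) + 1) / (y - C)) = C * (d + 2) + 1 := mul_div_cancel₀ _ hyC.ne'
  linarith

/-- Every admissible constant in the integral Hardy inequality is at least `y` as soon as some
truncation of `f (1 / (y s))` has positive integral. -/
lemma ofReal_le_of_hardy {f : ℝ → ℝ} (hmono : StrictMonoOn f (Ioi 0))
    (hconc : ConcaveOn ℝ (Ioi 0) f) (hone : f 1 = 0) {X : ℝ → Set (ℝ → ℝ)}
    (hX : ∀ t, 0 < t → deepClass (Ioi 0) t ⊆ X t) {C : ℝ≥0∞}
    (hC : ∀ u : ℝ → ℝ, (∀ t, 0 ≤ t → u t ∈ Ioi 0) → IntegrableOn u (Ici 0) →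
      (∀ t, 0 < t → u ∈ X t) →
      ∫⁻ t in Ioi 0,
          (integralMean (deviationMean (Ioi 0) fun x y => f (x / y)) (Ioi 0) u t).toENNReal ≤
        C * ∫⁻ t in Ioi 0, ENNReal.ofReal (u t))
    {y : ℝ} (hy : 0 < y)
    (hδ : ∃ δ, 0 < δ ∧ δ ≤ 1 ∧ 0 < ∫ s in Ioo 0 1, f (1 / (y * max s δ))) :
    ENNReal.ofReal y ≤ C := by
  obtain ⟨δ, hδ, hδ1, hpos⟩ := hδ
  rcases eq_or_ne C ⊤ with rfl | hCtop
  · exact le_top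
  rw [← ENNReal.ofReal_toReal hCtop]
  have hd1 : 1 ≤ 1 / δ := (one_le_div hδ).2 hδ1
  have hd0 : 0 < 1 / δ := one_pos.trans_le hd1
  refine ENNReal.ofReal_le_ofReal (le_of_forall_mul_le (d := Real.log (1 / δ))
    ENNReal.toReal_nonneg (Real.log_nonneg hd1) fun x hx => ?_)
  -- With `T = exp x / δ` the lower bound is `y * x` and the integral of the test function is at
  -- most `log (1/δ) + x + 2`, both affine in `x`.
  have hδT : 1 / δ ≤ 1 / δ * Real.exp x := le_mul_of_one_le_right hd0.le (Real.one_le_exp hx)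
  have hT : 1 ≤ 1 / δ * Real.exp x := hd1.trans hδT
  have h := (ofReal_mul_log_le_lintegral hmono hconc hone hy hδ hpos hT hδT).trans
    (hC (truncatedInv (1 / δ * Real.exp x)) (fun t _ => truncatedInv_pos hT t)
      (integrableOn_truncatedInv hT) fun t ht => hX t ht
        (continuous_mem_deepClass (continuous_truncatedInv hT) (truncatedInv_pos hT) t))
  have h2 := h.trans (mul_le_mul_right (lintegral_truncatedInv_le hT) C)
  rw [mul_div_cancel_left₀ _ hd0.ne', Real.log_exp, Real.log_mul hd0.ne' (Real.exp_pos x).ne',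
    Real.log_exp, ← ENNReal.ofReal_toReal hCtop, ← ENNReal.ofReal_mul ENNReal.toReal_nonneg] at h2
  have hd := Real.log_nonneg hd1
  exact (ENNReal.ofReal_le_ofReal_iff (by positivity)).1 h2

lemma hardyConst_eq_top {f : ℝ → ℝ} (hmono : StrictMonoOn f (Ioi 0))
    (hconc : ConcaveOn ℝ (Ioi 0) f) (hone : f 1 = 0) {X : ℝ → Set (ℝ → ℝ)}
    (hX : ∀ t, 0 < t → deepClass (Ioi 0) t ⊆ X t)
    (htop : ∫⁻ t in Ioo (0 : ℝ) 1, ENNReal.ofReal (f (1 / t)) = ⊤) :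
    hardyConst (Ioi 0) X (integralMean (deviationMean (Ioi 0) fun x y => f (x / y)) (Ioi 0)) =
      ⊤ := by
  refine sInf_eq_top.2 fun C hC => ENNReal.eq_top_of_forall_nnreal_le fun r => ?_
  have h1 : (1 : ℝ) ≤ r + 1 := le_add_of_nonneg_left r.2
  have := ofReal_le_of_hardy hmono hconc hone hX hC (one_pos.trans_le h1)
    (exists_truncation_pos_of_lintegral_eq_top hmono hconc hone htop h1)
  refine le_trans ?_ this
  rw [← ENNReal.ofReal_coe_nnreal]
  exact ENNReal.ofReal_le_ofReal (by linarith)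

lemma hardyConst_eq_ofReal {f : ℝ → ℝ} (hmono : StrictMonoOn f (Ioi 0))
    (hconc : ConcaveOn ℝ (Ioi 0) f) (hone : f 1 = 0) {X : ℝ → Set (ℝ → ℝ)}
    (hX : ∀ t, 0 < t → deepClass (Ioi 0) t ⊆ X t ∧
      X t ⊆ meanDomain (deviationMean (Ioi 0) fun x y => f (x / y)) (Ioi 0) t)
    (hfin : ∫⁻ t in Ioo (0 : ℝ) 1, ENNReal.ofReal (f (1 / t)) < ⊤) {c : ℝ} (hc : 0 < c)
    (hc0 : ∫ t in (0 : ℝ)..c, f (1 / t) = 0) :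
    hardyConst (Ioi 0) X (integralMean (deviationMean (Ioi 0) fun x y => f (x / y)) (Ioi 0)) =
      ENNReal.ofReal c := by
  refine le_antisymm (sInf_le fun u hpos hu hdom => ?_) (le_sInf fun C hC => ?_)
  · exact lintegral_integralMean_le hmono hconc hone hfin hc hc0 hpos hu
      fun t ht => (hX t ht).2 (hdom t ht)
  · have hΨc : ∫ s in Ioo 0 1, f (1 / (c * s)) = 0 := by
      rw [integral_one_div_mul_comp f hc, hc0, mul_zero]
    -- The averages are positive up to `1` and vanish at `c`. Hence `(1, c)` is nonempty, and its
    -- points, which satisfy the requirement `1 ≤ y` of the truncation lemma, approach `c` from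
    -- below.
    have hc1 : 1 < c := by
      by_contra! hle
      have h1 := integral_one_div_comp_pos hmono hconc hone hfin
      have h2 := integral_one_div_mul_comp f one_pos
      rcases hle.eq_or_lt with rfl | hlt
      · linarith
      · have := integral_one_div_mul_comp_lt hmono hconc hone hfin hc hlt
        rw [h2, inv_one, one_mul] at this
        linarith
    have hy : ∀ y ∈ Ioo 1 c, ENNReal.ofReal y ≤ C := fun y hy => by
      have hy0 : 0 < y := one_pos.trans hy.1
      refine ofReal_le_of_hardy hmono hconc hone (fun t ht => (hX t ht).1) hC hy0
        (exists_truncation_pos_of_integral_pos hmono hconc hone hfin hy.1.le ?_)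
      exact hΨc.symm.trans_lt (integral_one_div_mul_comp_lt hmono hconc hone hfin hy0 hy.2)
    refine le_of_tendsto (ENNReal.continuous_ofReal.continuousWithinAt (s := Iio c)) ?_
    filter_upwards [Ioo_mem_nhdsLT hc1] using hy

end IntegralHardy

end

theorem mainTheorem5 (f : ℝ → ℝ)
    (hmono : StrictMonoOn f (Set.Ioi 0)) (hconc : ConcaveOn ℝ (Set.Ioi 0) f) (hone : f 1 = 0)
    (E : ℝ → ℝ → ℝ) (hE : ∀ x y : ℝ, E x y = f (x / y))
    (D : IntegralHardy.WeightedMean) (hD : D = IntegralHardy.deviationMean (Set.Ioi 0) E) :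
    IntegralHardy.IsDeviation (Set.Ioi 0) E ∧
    (∀ t : ℝ, 0 < t →
      IntegralHardy.deepClass (Set.Ioi 0) t ⊆ IntegralHardy.meanDomain D (Set.Ioi 0) t) ∧
    ∀ X : ℝ → Set (ℝ → ℝ),
      (∀ t : ℝ, 0 < t → IntegralHardy.deepClass (Set.Ioi 0) t ⊆ X t ∧
        X t ⊆ IntegralHardy.meanDomain D (Set.Ioi 0) t) →
      (IntegralHardy.hardyConst (Set.Ioi 0) X (IntegralHardy.integralMean D (Set.Ioi 0)) < ⊤ ↔
        ∫⁻ t in Set.Ioo (0 : ℝ) 1, ENNReal.ofReal (f (1 / t)) < ⊤) ∧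
      (∫⁻ t in Set.Ioo (0 : ℝ) 1, ENNReal.ofReal (f (1 / t)) < ⊤ →
        ∃ c : ℝ, 0 < c ∧
          IntervalIntegrable (fun t => f (1 / t)) MeasureTheory.volume 0 c ∧
          (∫ t in (0 : ℝ)..c, f (1 / t)) = 0 ∧
          (∀ c' : ℝ, 0 < c' → (∫ t in (0 : ℝ)..c', f (1 / t)) = 0 → c' = c) ∧
          IntegralHardy.hardyConst (Set.Ioi 0) X (IntegralHardy.integralMean D (Set.Ioi 0)) =
            ENNReal.ofReal c) := by
  obtain rfl : E = fun x y => f (x / y) := funext₂ hE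
  subst hD
  refine ⟨IntegralHardy.isDeviation_of_concave hmono hconc hone,
    fun t ht => IntegralHardy.deepClass_subset_meanDomain hmono hconc hone ht, fun X hX => ?_⟩
  refine ⟨⟨fun h => ?_, fun hfin => ?_⟩, fun hfin => ?_⟩
  · by_contra htop
    exact h.ne (IntegralHardy.hardyConst_eq_top hmono hconc hone (fun t ht => (hX t ht).1)
      (not_lt_top_iff.1 htop))
  · obtain ⟨c, hc, hc0⟩ := IntegralHardy.exists_integral_eq_zero hmono hconc hone hfin
    rw [IntegralHardy.hardyConst_eq_ofReal hmono hconc hone hX hfin hc hc0]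
    exact ENNReal.ofReal_lt_top
  · obtain ⟨c, hc, hc0⟩ := IntegralHardy.exists_integral_eq_zero hmono hconc hone hfin
    exact ⟨c, hc, IntegralHardy.intervalIntegrable_one_div_comp hmono hconc hone hfin hc, hc0,
      fun c' hc' hc0' =>
        IntegralHardy.eq_of_integral_eq_zero hmono hconc hone hfin hc' hc hc0' hc0,
      IntegralHardy.hardyConst_eq_ofReal hmono hconc hone hX hfin hc hc0⟩
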